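/- All graphs are finite, simple and nonempty. For a graph $G$ and an integer $\ell\ge 0$, let $\mathrm{TAR}_\ell(G)$ be the graph whose vertices are the independent sets of $G$ of size at least $\ell$, two distinct ones being adjacent if one is obtained from the other by adding a single vertex. Write $I\leftrightarrow_\ell^G J$ if $I$ and $J$ are independent sets of $G$ of size at least $\ell$ and $\mathrm{TAR}_\ell(G)$ contains a path from $I$ to $J$. A generalized cotree for a graph $G$ is a rooted binary tree $T$, in which every nonleaf node has an ordered pair of children and is either a union node or a join node, together with a graph $G_u$ for every leaf $u$, these graphs being pairwise vertex-disjoint. For a nonleaf node $u$ with children $v,w$, the graph $G_u$ is the disjoint union of $G_v$ and $G_w$ if $u$ is a union node, and their complete join (the disjoint union plus all edges between $V(G_v)$ and $V(G_w)$) if $u$ is a join node; it is required that $G_r=G$ for the root $r$. Put $V_u=V(G_u)$. A leaf $u$ is trivial if $|V_u|=1$. For an independent set $I$ of $G$, a node $v$ and $0\le \ell\le |I\cap V_v|$, let $\mathrm{RIS}^I_\ell(v)$ be the maximum of $|J|$ over all independent sets $J$ of $G_v$ with $(I\cap V_v)\leftrightarrow_\ell^{G_v} J$. Theorem. Let $T$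 be a generalized cotree for a graph $G$ on $n$ vertices, let $k\in\mathbb N$, and let $A$ and $B$ be independent sets of $G$. Suppose that for every nontrivial leaf $v$ of $T$ the following are known: the values $\mathrm{RIS}^A_\ell(v)$ for $0\le\ell\le|A\cap V_v|$, the values $\mathrm{RIS}^B_\ell(v)$ for $0\le\ell\le|B\cap V_v|$, and, for every $0\le\ell\le\min\{|A\cap V_v|,|B\cap V_v|\}$, whether $(A\cap V_v)\leftrightarrow_\ell^{G_v}(B\cap V_v)$. Then it can be decided in time $O(n^2)$ whether $A\leftrightarrow_k^G B$. That is, there are one algorithm (a program for a uniform-cost random access machine with addition, truncated subtraction, tests for zero and indirect addressing) and one constant $C$ such that, on every input consisting of $G$, $T$, $k$, $A$, $B$ and the known values listed above, the algorithm halts after at most $C n^2$ steps and correctly answers whether $A\leftrightarrow_k^G B$. -/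

import Mathlib

namespace ISR

/-! ### Graphs on a finite part of a ground set -/

/-- A simple graph with finite vertex set `verts ⊆ V`; all its edges join vertices of `verts`. -/
structure FinGraph (V : Type*) extends SimpleGraph V where
  verts : Finset V
  mem_of_adj : ∀ u v, Adj u v → u ∈ verts

namespace FinGraph

variable {V : Type*}

/-- A simple graph on a finite type, as a graph with vertex set the whole type. -/
def ofGraph [Fintype V] (G : SimpleGraph V) : FinGraph V where
  toSimpleGraph := G
  verts := Finset.univ
  mem_of_adj := fun u _ _ => Finset.mem_univ u

/-- The union of two graphs (it is used for vertex-disjoint graphs only). -/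
def union [DecidableEq V] (G H : FinGraph V) : FinGraph V where
  toSimpleGraph := G.toSimpleGraph ⊔ H.toSimpleGraph
  verts := G.verts ∪ H.verts
  mem_of_adj := by
    rintro u v (h | h)
    · exact Finset.mem_union_left _ (G.mem_of_adj u v h)
    · exact Finset.mem_union_right _ (H.mem_of_adj u v h)

/-- The complete join: the union together with all edges between a vertex of `G` and a vertex of
`H` (it is used for vertex-disjoint graphs only). -/
def join [DecidableEq V] (G H : FinGraph V) : FinGraph V where
  toSimpleGraph := (G.toSimpleGraph ⊔ H.toSimpleGraph) ⊔
    SimpleGraph.fromRel (fun y z => y ∈ G.verts ∧ z ∈ H.verts)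
  verts := G.verts ∪ H.verts
  mem_of_adj := by
    rintro u v ((h | h) | ⟨_, h | h⟩)
    · exact Finset.mem_union_left _ (G.mem_of_adj u v h)
    · exact Finset.mem_union_right _ (H.mem_of_adj u v h)
    · exact Finset.mem_union_left _ h.1
    · exact Finset.mem_union_right _ h.2

/-- `J` is an independent set of `G`. -/
def IsIndep (G : FinGraph V) (J : Finset V) : Prop :=
  J ⊆ G.verts ∧ G.toSimpleGraph.IsIndepSet (J : Set V)

/-- The graph `TAR_k(G)`: its vertices are the independent sets of `G` of size at least `k`; two
distinct ones are adjacent if one is obtained from the other by adding one vertex. -/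
def TAR [DecidableEq V] (G : FinGraph V) (k : ℕ) :
    SimpleGraph {J : Finset V // G.IsIndep J ∧ k ≤ J.card} where
  Adj I J := I ≠ J ∧ ∃ v ∈ G.verts, insert v I.1 = J.1 ∨ I.1 = insert v J.1
  symm := ⟨fun _ _ h => ⟨h.1.symm, h.2.imp fun _ hv => ⟨hv.1, hv.2.symm.imp Eq.symm Eq.symm⟩⟩⟩
  loopless := ⟨fun _ h => h.1 rfl⟩

/-- `I` and `J` are independent sets of `G` of size at least `k`, and `TAR_k(G)` contains a path
from `I` to `J`. -/
def TARReach [DecidableEq V] (G : FinGraph V) (k : ℕ) (I J : Finset V) : Prop :=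
  ∃ (hI : G.IsIndep I ∧ k ≤ I.card) (hJ : G.IsIndep J ∧ k ≤ J.card),
    (G.TAR k).Reachable ⟨I, hI⟩ ⟨J, hJ⟩

/-- The maximum size of an independent set of `G` that is reachable in `TAR_ℓ(G)` from the part of
`I` in `G`. It is meaningful for `ℓ ≤ |I ∩ V(G)|`. -/
noncomputable def RIS [DecidableEq V] (G : FinGraph V) (I : Finset V) (ℓ : ℕ) : ℕ :=
  sSup {s | ∃ J : Finset V, G.TARReach ℓ (I ∩ G.verts) J ∧ J.card = s}

end FinGraph

/-! ### Generalized cotrees -/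

/-- Rooted binary trees with ordered children, whose leaves carry graphs and whose inner nodes are
union nodes or join nodes. A node is identified with the subtree below it. -/
inductive Cotree (V : Type*)
  | leaf (H : FinGraph V) : Cotree V
  | union (l r : Cotree V) : Cotree V
  | join (l r : Cotree V) : Cotree V

namespace Cotree

variable {V : Type*}

/-- The graph associated with (the root of) the tree. -/
def graph [DecidableEq V] : Cotree V → FinGraph V
  | leaf H => H
  | union l r => l.graph.union r.graph
  | join l r => l.graph.join r.graph

/-- The graphs at the leaves are nonempty and pairwise disjoint. -/
def WellFormed [DecidableEq V] : Cotree V → Prop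
  | leaf H => H.verts.Nonempty
  | union l r => l.WellFormed ∧ r.WellFormed ∧ Disjoint l.graph.verts r.graph.verts
  | join l r => l.WellFormed ∧ r.WellFormed ∧ Disjoint l.graph.verts r.graph.verts

/-- `T` is a generalized cotree for the graph `G`. -/
def IsGeneralizedCotreeFor [DecidableEq V] [Fintype V] (T : Cotree V) (G : SimpleGraph V) : Prop :=
  T.WellFormed ∧ T.graph = FinGraph.ofGraph G

/-- The nodes of the tree (as subtrees) in preorder. -/
def nodes : Cotree V → List (Cotree V)
  | leaf H => [leaf H]
  | union l r => union l r :: (l.nodes ++ r.nodes)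
  | join l r => join l r :: (l.nodes ++ r.nodes)

end Cotree

/-! ### A random access machine with uniform cost

The memory consists of arrays `0, 1, 2, …` of natural numbers. A program is a fixed finite text, so
it names a fixed finite number of arrays (which could be interleaved into a single array at the cost
of a constant factor); the positions in an array are computed at run time. The only arithmetic is
addition and truncated subtraction (which also gives comparisons). -/

/-- `m a i` is the content of cell `i` of array `a`. -/
abbrev Mem : Type := ℕ → ℕ → ℕ

inductive Expr
  | const (c : ℕ) : Expr
  | read (a : ℕ) (i : Expr) : Expr
  | add (x y : Expr) : Expr
  | sub (x y : Expr) : Expr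

namespace Expr

def eval (m : Mem) : Expr → ℕ
  | const c => c
  | read a i => m a (i.eval m)
  | add x y => x.eval m + y.eval m
  | sub x y => x.eval m - y.eval m

/-- The number of elementary operations needed to evaluate an expression. -/
def cost : Expr → ℕ
  | const _ => 1
  | read _ i => 1 + i.cost
  | add x y => 1 + x.cost + y.cost
  | sub x y => 1 + x.cost + y.cost

end Expr

inductive Prog
  | skip : Prog
  | write (a : ℕ) (i x : Expr) : Prog
  | seq (p q : Prog) : Prog
  | ite (b : Expr) (p q : Prog) : Prog
  | loop (b : Expr) (p : Prog) : Prog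

/-- `Exec p m t m'`: program `p`, started with memory `m`, halts after exactly `t` elementary steps
with memory `m'`. A test succeeds if its value is nonzero; `loop b p` repeats `p` while `b` holds. -/
inductive Exec : Prog → Mem → ℕ → Mem → Prop
  | skip (m : Mem) : Exec Prog.skip m 1 m
  | write (a : ℕ) (i x : Expr) (m : Mem) :
      Exec (Prog.write a i x) m (1 + i.cost + x.cost)
        (Function.update m a (Function.update (m a) (i.eval m) (x.eval m)))
  | seq {p q : Prog} {m m' m'' : Mem} {t t' : ℕ} :
      Exec p m t m' → Exec q m' t' m'' → Exec (Prog.seq p q) m (t + t') m''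
  | ite_pos {b : Expr} {p q : Prog} {m m' : Mem} {t : ℕ} :
      b.eval m ≠ 0 → Exec p m t m' → Exec (Prog.ite b p q) m (1 + b.cost + t) m'
  | ite_neg {b : Expr} {p q : Prog} {m m' : Mem} {t : ℕ} :
      b.eval m = 0 → Exec q m t m' → Exec (Prog.ite b p q) m (1 + b.cost + t) m'
  | loop_done {b : Expr} {p : Prog} {m : Mem} :
      b.eval m = 0 → Exec (Prog.loop b p) m (1 + b.cost) m
  | loop_step {b : Expr} {p : Prog} {m m' m'' : Mem} {t t' : ℕ} :
      b.eval m ≠ 0 → Exec p m t m' → Exec (Prog.loop b p) m' t' m'' →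
        Exec (Prog.loop b p) m (1 + b.cost + t + t') m''

/-- The machine is deterministic, so running time and result of a run are well defined. -/
theorem Exec.deterministic {p : Prog} {m m₁ : Mem} {t₁ : ℕ} (h₁ : Exec p m t₁ m₁) :
    ∀ {m₂ : Mem} {t₂ : ℕ}, Exec p m t₂ m₂ → t₁ = t₂ ∧ m₁ = m₂ := by
  induction h₁ with
  | skip => intro _ _ h; cases h; exact ⟨rfl, rfl⟩
  | write => intro _ _ h; cases h; exact ⟨rfl, rfl⟩
  | seq _ _ ih ih' =>
    intro _ _ h
    cases h with
    | seq h h' =>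
      obtain ⟨rfl, rfl⟩ := ih h
      obtain ⟨rfl, rfl⟩ := ih' h'
      exact ⟨rfl, rfl⟩
  | ite_pos hb _ ih =>
    intro _ _ h
    cases h with
    | ite_pos _ h => obtain ⟨rfl, rfl⟩ := ih h; exact ⟨rfl, rfl⟩
    | ite_neg hb' _ => exact absurd hb' hb
  | ite_neg hb _ ih =>
    intro _ _ h
    cases h with
    | ite_pos hb' _ => exact absurd hb hb'
    | ite_neg _ h => obtain ⟨rfl, rfl⟩ := ih h; exact ⟨rfl, rfl⟩
  | loop_done hb =>
    intro _ _ h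
    cases h with
    | loop_done _ => exact ⟨rfl, rfl⟩
    | loop_step hb' _ _ => exact absurd hb hb'
  | loop_step hb _ _ ih ih' =>
    intro _ _ h
    cases h with
    | loop_done hb' => exact absurd hb' hb
    | loop_step _ h h' =>
      obtain ⟨rfl, rfl⟩ := ih h
      obtain ⟨rfl, rfl⟩ := ih' h'
      exact ⟨rfl, rfl⟩

/-! ### The input -/

open Classical in
/-- The memory `m` holds the input: the graph `G` with vertices `0, …, n - 1`, the tree `T` with
its nodes numbered in preorder, the number `k`, the sets `A` and `B`, and for every nontrivial leaf
the known values. Row `i` of a two-dimensional table occupies the cells from `i * (n + 1)` on.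
Nothing is said about table entries of trivial leaves, of inner nodes, and of irrelevant `ℓ`.

Arrays: `0` the numbers `n`, `k`, `|V(T)|`; `1` adjacency matrix; `2`, `3` characteristic vectors
of `A`, `B`; `4` kind of a node (`0` leaf, `1` union, `2` join); `5`, `6` left and right child;
`7` number of vertices at a leaf; `8` the leaf that contains a given vertex; `9`, `10` the values
`RIS^A`, `RIS^B`; `11` reachability within a leaf. All other arrays are zero. -/
structure IsInput {n : ℕ} (G : SimpleGraph (Fin n)) (T : Cotree (Fin n)) (k : ℕ)
    (A B : Finset (Fin n)) (m : Mem) : Prop where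
  order : m 0 0 = n
  bound : m 0 1 = k
  nodeCount : m 0 2 = T.nodes.length
  adj : ∀ u v : Fin n, m 1 (u * n + v) = if G.Adj u v then 1 else 0
  setA : ∀ v : Fin n, m 2 v = if v ∈ A then 1 else 0
  setB : ∀ v : Fin n, m 3 v = if v ∈ B then 1 else 0
  union : ∀ (i : ℕ) (l r : Cotree (Fin n)), T.nodes[i]? = some (Cotree.union l r) →
    m 4 i = 1 ∧ m 5 i = i + 1 ∧ m 6 i = i + 1 + l.nodes.length
  join : ∀ (i : ℕ) (l r : Cotree (Fin n)), T.nodes[i]? = some (Cotree.join l r) →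
    m 4 i = 2 ∧ m 5 i = i + 1 ∧ m 6 i = i + 1 + l.nodes.length
  leaf : ∀ (i : ℕ) (H : FinGraph (Fin n)), T.nodes[i]? = some (Cotree.leaf H) →
    m 4 i = 0 ∧ m 7 i = H.verts.card ∧ ∀ v ∈ H.verts, m 8 v = i
  risA : ∀ (i : ℕ) (H : FinGraph (Fin n)), T.nodes[i]? = some (Cotree.leaf H) → H.verts.card ≠ 1 →
    ∀ ℓ ≤ (A ∩ H.verts).card, m 9 (i * (n + 1) + ℓ) = H.RIS A ℓ
  risB : ∀ (i : ℕ) (H : FinGraph (Fin n)), T.nodes[i]? = some (Cotree.leaf H) → H.verts.card ≠ 1 →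
    ∀ ℓ ≤ (B ∩ H.verts).card, m 10 (i * (n + 1) + ℓ) = H.RIS B ℓ
  reach : ∀ (i : ℕ) (H : FinGraph (Fin n)), T.nodes[i]? = some (Cotree.leaf H) → H.verts.card ≠ 1 →
    ∀ ℓ ≤ min (A ∩ H.verts).card (B ∩ H.verts).card,
      m 11 (i * (n + 1) + ℓ) = if H.TARReach ℓ (A ∩ H.verts) (B ∩ H.verts) then 1 else 0
  blank : ∀ a, 12 ≤ a → ∀ i, m a i = 0

end ISR

namespace ISR

namespace FinGraph

variable {V : Type*} {G H : FinGraph V} {k ℓ : ℕ} {A B I J K X Y : Finset V}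

/-! The values at an inner node follow from those at its two children, and only sizes and thresholds
enter; the adjacency matrix is never consulted.

Union of `G` and `H`. Suppose that from `A`, at threshold `ℓ`, a set with `x` tokens in `G` and `y`
in `H` is reachable. While the `y` tokens rest, the part in `G` may shrink to `ℓ - y`, so `x` can be
raised to the RIS value of `G` at `ℓ - y`; then `y` can be raised in the same way. Once neither
grows (`Saturated`), the bounds support each other: at most `x` tokens in `G` force at least `ℓ - x`
in `H`, which in turn keeps the part in `H` at most `y`, and symmetrically. Hence every reachable
set splits into parts reachable at the thresholds `ℓ - y` and `ℓ - x` (`TARReach.of_union`). The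
maximum is therefore `x + y` (`Saturated.ris_union`), and `A`, `B` are connected iff their saturated
pairs agree and their parts are connected at these thresholds (`Saturated.tarReach_union_iff`).

Join. A nonempty independent set lies on one side, and at a positive threshold it can never change
sides (`tarReach_join_iff`). At threshold `0` everything is connected through the empty set.

Time. A pair attained at `ℓ + 1` is attained at `ℓ`, so thresholds are treated in decreasing order
without restarting. Each round raises `x + y ≤ n` or lowers `ℓ`, which gives at most `n + 1` rounds
per node and set (`UnionRisInv.body`), and there are fewer than `2 * n` nodes
(`Cotree.WellFormed.length_nodes_lt`). In reverse preorder children precede their parents. -/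

theorem IsIndep.mono (h : G.IsIndep J) (hI : I ⊆ J) : G.IsIndep I :=
  ⟨hI.trans h.1, Set.Pairwise.mono (Finset.coe_subset.2 hI) h.2⟩

theorem isIndep_of_card_eq_one (h : G.verts.card = 1) (hJ : J ⊆ G.verts) : G.IsIndep J := by
  refine ⟨hJ, fun u hu v hv huv => absurd ?_ huv⟩
  exact Finset.card_le_one.1 h.le u (hJ hu) v (hJ hv)

theorem mem_of_adj_right {u v : V} (h : G.Adj u v) : v ∈ G.verts := G.mem_of_adj v u h.symm

variable [DecidableEq V]

/-! ### Reachability by token addition and removal -/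

/-- `J` is an independent set of size at least `k` that differs from `I` in at most one vertex. -/
def Step (G : FinGraph V) (k : ℕ) (I J : Finset V) : Prop :=
  G.IsIndep J ∧ k ≤ J.card ∧ ∃ v ∈ G.verts, insert v I = J ∨ I = insert v J

/-- Replaces paths of subtype elements by a relation on finite sets, which suits induction. `Step`
constrains only its target, so the conditions on the start are stated separately. -/
theorem tarReach_iff : G.TARReach k I J ↔
    G.IsIndep I ∧ k ≤ I.card ∧ Relation.ReflTransGen (G.Step k) I J := by
  constructor
  · rintro ⟨hI, hJ, h⟩
    refine ⟨hI.1, hI.2, ?_⟩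
    rw [SimpleGraph.reachable_iff_reflTransGen] at h
    exact Relation.ReflTransGen.lift (p := G.Step k) Subtype.val
      (fun _ b hab => ⟨b.2.1, b.2.2, hab.2⟩) _ _ h
  · rintro ⟨h1, h2, h⟩
    refine ⟨⟨h1, h2⟩, ?_⟩
    induction h with
    | refl => exact ⟨⟨h1, h2⟩, SimpleGraph.Reachable.refl _⟩
    | @tail K L _ hs ih =>
      obtain ⟨hK, hr⟩ := ih
      refine ⟨⟨hs.1, hs.2.1⟩, ?_⟩
      -- `Step` permits standing still, `TAR` does not; such steps are dropped.
      by_cases hKL : K = L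
      · subst hKL; exact hr
      · refine hr.trans (SimpleGraph.Adj.reachable ⟨?_, hs.2.2⟩)
        intro hc
        exact hKL (congrArg Subtype.val hc)

theorem TARReach.indep_left (h : G.TARReach k I J) : G.IsIndep I := h.1.1
theorem TARReach.card_left (h : G.TARReach k I J) : k ≤ I.card := h.1.2
theorem TARReach.indep_right (h : G.TARReach k I J) : G.IsIndep J := h.2.1.1
theorem TARReach.card_right (h : G.TARReach k I J) : k ≤ J.card := h.2.1.2

theorem TARReach.refl (h : G.IsIndep I) (hk : k ≤ I.card) : G.TARReach k I I :=
  ⟨⟨h, hk⟩, ⟨h, hk⟩, SimpleGraph.Reachable.refl _⟩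

theorem TARReach.symm : G.TARReach k I J → G.TARReach k J I :=
  fun ⟨hI, hJ, h⟩ => ⟨hJ, hI, h.symm⟩

theorem TARReach.trans : G.TARReach k I J → G.TARReach k J K → G.TARReach k I K :=
  fun ⟨hI, _, h⟩ ⟨_, hK, h'⟩ => ⟨hI, hK, h.trans h'⟩

theorem TARReach.mono (hk : ℓ ≤ k) (h : G.TARReach k I J) : G.TARReach ℓ I J := by
  rw [tarReach_iff] at h ⊢
  exact ⟨h.1, hk.trans h.2.1,
    Relation.ReflTransGen.mono (r := G.Step k)
      (fun _ _ hs => ⟨hs.1, hk.trans hs.2.1, hs.2.2⟩) _ _ h.2.2⟩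

theorem Step.tarReach (hI : G.IsIndep I) (hk : k ≤ I.card) (h : G.Step k I J) :
    G.TARReach k I J :=
  tarReach_iff.2 ⟨hI, hk, Relation.ReflTransGen.single h⟩

/-- Without a size constraint the vertices can be removed one at a time. -/
theorem tarReach_zero_empty (h : G.IsIndep I) : G.TARReach 0 I ∅ := by
  induction I using Finset.induction_on with
  | empty => exact TARReach.refl h (Nat.zero_le _)
  | insert v I _ ih =>
    have hI := h.mono (Finset.subset_insert v I)
    exact TARReach.trans (Step.tarReach h (Nat.zero_le _)
      ⟨hI, Nat.zero_le _, v, h.1 (Finset.mem_insert_self v I), Or.inr rfl⟩) (ih hI)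

theorem tarReach_zero (hI : G.IsIndep I) (hJ : G.IsIndep J) : G.TARReach 0 I J :=
  (tarReach_zero_empty hI).trans (tarReach_zero_empty hJ).symm

/-! ### The largest reachable size -/

theorem ris_eq {r : ℕ} (h : G.TARReach ℓ (A ∩ G.verts) J) (hr : J.card = r)
    (hmax : ∀ K, G.TARReach ℓ (A ∩ G.verts) K → K.card ≤ r) : G.RIS A ℓ = r := by
  apply le_antisymm
  · exact csSup_le ⟨r, J, h, hr⟩ (by rintro _ ⟨K, hK, rfl⟩; exact hmax K hK)
  · exact le_csSup ⟨r, by rintro _ ⟨K, hK, rfl⟩; exact hmax K hK⟩ ⟨J, h, hr⟩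

theorem card_le_ris (h : G.TARReach ℓ (A ∩ G.verts) J) : J.card ≤ G.RIS A ℓ :=
  le_csSup ⟨G.verts.card, by
    rintro _ ⟨K, hK, rfl⟩; exact Finset.card_le_card hK.indep_right.1⟩ ⟨J, h, rfl⟩

/-- The set of reachable sizes is bounded by the order of `G`, and the start itself makes it
nonempty; this excludes the default value `sSup ∅ = 0`. -/
theorem exists_card_eq_ris (hA : G.IsIndep (A ∩ G.verts)) (hℓ : ℓ ≤ (A ∩ G.verts).card) :
    ∃ J, G.TARReach ℓ (A ∩ G.verts) J ∧ J.card = G.RIS A ℓ :=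
  Nat.sSup_mem (s := {s | ∃ J : Finset V, G.TARReach ℓ (A ∩ G.verts) J ∧ J.card = s})
    ⟨_, _, TARReach.refl hA hℓ, rfl⟩ ⟨G.verts.card, by
      rintro _ ⟨K, hK, rfl⟩; exact Finset.card_le_card hK.indep_right.1⟩

theorem eq_verts_of_card_eq_one (h : G.verts.card = 1) (h1 : 1 ≤ (A ∩ G.verts).card) :
    A ∩ G.verts = G.verts :=
  Finset.eq_of_subset_of_card_le Finset.inter_subset_right (h ▸ h1)

/-- At threshold `0` everything is reachable; a positive `ℓ` forces the set to contain the only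
vertex already. -/
theorem ris_of_card_eq_one (h : G.verts.card = 1) (hℓ : ℓ ≤ (A ∩ G.verts).card) :
    G.RIS A ℓ = 1 := by
  have hA := isIndep_of_card_eq_one h (Finset.inter_subset_right : A ∩ G.verts ⊆ _)
  have hV := isIndep_of_card_eq_one h (Finset.Subset.refl G.verts)
  refine ris_eq (J := G.verts) ?_ h fun K hK => h ▸ Finset.card_le_card hK.indep_right.1
  rcases Nat.eq_zero_or_pos ℓ with rfl | hpos
  · exact tarReach_zero hA hV
  · have e := eq_verts_of_card_eq_one h (hpos.trans_le hℓ)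
    rw [e] at hℓ ⊢
    exact TARReach.refl hV hℓ

theorem tarReach_of_card_eq_one (h : G.verts.card = 1) (hA : ℓ ≤ (A ∩ G.verts).card)
    (hB : ℓ ≤ (B ∩ G.verts).card) : G.TARReach ℓ (A ∩ G.verts) (B ∩ G.verts) := by
  rcases Nat.eq_zero_or_pos ℓ with rfl | hpos
  · exact tarReach_zero (isIndep_of_card_eq_one h Finset.inter_subset_right)
      (isIndep_of_card_eq_one h Finset.inter_subset_right)
  · have e := eq_verts_of_card_eq_one h (hpos.trans_le hA)
    rw [e] at hA ⊢
    rw [eq_verts_of_card_eq_one h (hpos.trans_le hB)]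
    exact TARReach.refl (isIndep_of_card_eq_one h (Finset.Subset.refl G.verts)) hA

/-! ### Disjoint unions -/

theorem union_comm (G H : FinGraph V) : G.union H = H.union G := by
  simp only [union, sup_comm, Finset.union_comm]

/-- Both ends of an edge lie in the graph that it comes from, so disjointness is not needed here. -/
theorem isIndep_union_iff : (G.union H).IsIndep J ↔
    J ⊆ G.verts ∪ H.verts ∧ G.IsIndep (J ∩ G.verts) ∧ H.IsIndep (J ∩ H.verts) := by
  constructor
  · rintro ⟨h, h'⟩
    refine ⟨h, ⟨Finset.inter_subset_right, fun u hu v hv huv ha => ?_⟩,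
      ⟨Finset.inter_subset_right, fun u hu v hv huv ha => ?_⟩⟩
    · exact h' (Finset.mem_inter.1 hu).1 (Finset.mem_inter.1 hv).1 huv (Or.inl ha)
    · exact h' (Finset.mem_inter.1 hu).1 (Finset.mem_inter.1 hv).1 huv (Or.inr ha)
  · rintro ⟨h, hG, hH⟩
    refine ⟨h, fun u hu v hv huv => ?_⟩
    rintro (ha | ha)
    · exact hG.2 (Finset.mem_inter.2 ⟨hu, G.mem_of_adj _ _ ha⟩)
        (Finset.mem_inter.2 ⟨hv, mem_of_adj_right ha⟩) huv ha
    · exact hH.2 (Finset.mem_inter.2 ⟨hu, H.mem_of_adj _ _ ha⟩)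
        (Finset.mem_inter.2 ⟨hv, mem_of_adj_right ha⟩) huv ha

theorem union_inter_verts_left (hd : Disjoint G.verts H.verts) (hX : X ⊆ G.verts)
    (hY : Y ⊆ H.verts) : (X ∪ Y) ∩ G.verts = X := by
  rw [Finset.union_inter_distrib_right, Finset.inter_eq_left.2 hX,
    Finset.disjoint_iff_inter_eq_empty.1 (hd.symm.mono_left hY), Finset.union_empty]

theorem isIndep_union (hd : Disjoint G.verts H.verts) (hX : G.IsIndep X) (hY : H.IsIndep Y) :
    (G.union H).IsIndep (X ∪ Y) := by
  rw [isIndep_union_iff, union_inter_verts_left hd hX.1 hY.1, Finset.union_comm X,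
    union_inter_verts_left hd.symm hY.1 hX.1, Finset.union_comm Y]
  exact ⟨Finset.union_subset_union hX.1 hY.1, hX, hY⟩

theorem card_union_of_subset_verts (hd : Disjoint G.verts H.verts) (hX : X ⊆ G.verts)
    (hY : Y ⊆ H.verts) : (X ∪ Y).card = X.card + Y.card :=
  Finset.card_union_of_disjoint (hd.mono hX hY)

/-- The tokens on `Y` rest and count towards the threshold, so the moving part only has to keep `ℓ -
Y.card`; truncation covers the case of a large `Y`. -/
theorem TARReach.union_right (hd : Disjoint G.verts H.verts) (hY : H.IsIndep Y)
    (h : G.TARReach (ℓ - Y.card) I J) : (G.union H).TARReach ℓ (I ∪ Y) (J ∪ Y) := by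
  have key : ∀ X, G.IsIndep X → ℓ - Y.card ≤ X.card → ℓ ≤ (X ∪ Y).card := fun X hX hc => by
    rw [card_union_of_subset_verts hd hX.1 hY.1]; omega
  rw [tarReach_iff] at h ⊢
  refine ⟨isIndep_union hd h.1 hY, key I h.1 h.2.1,
    Relation.ReflTransGen.lift (r := G.Step (ℓ - Y.card)) (· ∪ Y) (fun K L hs => ?_) _ _ h.2.2⟩
  obtain ⟨hL, hc, v, hv, hs⟩ := hs
  refine ⟨isIndep_union hd hL hY, key L hL hc, v, Finset.mem_union_left _ hv, ?_⟩
  simp only [← Finset.insert_union]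
  exact hs.imp (congrArg (· ∪ Y)) (congrArg (· ∪ Y))

theorem TARReach.union_left (hd : Disjoint G.verts H.verts) (hX : G.IsIndep X)
    (h : H.TARReach (ℓ - X.card) I J) : (G.union H).TARReach ℓ (X ∪ I) (X ∪ J) := by
  rw [union_comm, Finset.union_comm X, Finset.union_comm X]
  exact h.union_right hd.symm hX

theorem card_inter_add_card_inter (hd : Disjoint G.verts H.verts)
    (hJ : J ⊆ G.verts ∪ H.verts) : (J ∩ G.verts).card + (J ∩ H.verts).card = J.card := by
  rw [← Finset.card_union_of_disjoint
    (hd.mono Finset.inter_subset_right Finset.inter_subset_right),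
    ← Finset.inter_union_distrib_left, Finset.inter_eq_left.2 hJ]

/-- A change at a vertex of `G` leaves the part in `H` alone. As that part has at most `y` vertices,
the new part in `G` has at least `ℓ - y`. -/
theorem step_union_of_mem {v : V} (hd : Disjoint G.verts H.verts) (hv : v ∈ G.verts)
    (hK : (G.union H).IsIndep K) (hc : ℓ ≤ K.card)
    (hs : insert v J = K ∨ J = insert v K) {y : ℕ} (hy : (J ∩ H.verts).card ≤ y) :
    G.Step (ℓ - y) (J ∩ G.verts) (K ∩ G.verts) ∧ K ∩ H.verts = J ∩ H.verts := by
  have hvH : v ∉ H.verts := Finset.disjoint_left.1 hd hv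
  have hKH : K ∩ H.verts = J ∩ H.verts := by
    rcases hs with rfl | rfl <;> rw [Finset.insert_inter_of_notMem hvH]
  have hcard := card_inter_add_card_inter hd hK.1
  rw [hKH] at hcard
  refine ⟨⟨(isIndep_union_iff.1 hK).2.1, by omega, v, hv, ?_⟩, hKH⟩
  rcases hs with rfl | rfl
  · exact Or.inl (Finset.insert_inter_of_mem hv).symm
  · exact Or.inr (Finset.insert_inter_of_mem hv)

/-- If `x` and `y` bound the sizes reachable in `G` and `H` with the thresholds `ℓ - y` and `ℓ - x`,
then everything reachable in the union decomposes accordingly. -/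
theorem TARReach.of_union (hd : Disjoint G.verts H.verts) {x y : ℕ}
    (hG : ℓ - y ≤ (I ∩ G.verts).card) (hH : ℓ - x ≤ (I ∩ H.verts).card)
    (hx : ∀ X, G.TARReach (ℓ - y) (I ∩ G.verts) X → X.card ≤ x)
    (hy : ∀ Y, H.TARReach (ℓ - x) (I ∩ H.verts) Y → Y.card ≤ y)
    (h : (G.union H).TARReach ℓ I J) :
    G.TARReach (ℓ - y) (I ∩ G.verts) (J ∩ G.verts) ∧
      H.TARReach (ℓ - x) (I ∩ H.verts) (J ∩ H.verts) := by
  rw [tarReach_iff] at h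
  obtain ⟨hI, hc, h⟩ := h
  induction h with
  | refl =>
    rw [isIndep_union_iff] at hI
    exact ⟨TARReach.refl hI.2.1 hG, TARReach.refl hI.2.2 hH⟩
  | @tail J K _ hs ih =>
    obtain ⟨hK, hcK, v, hv, hs⟩ := hs
    obtain ⟨h1, h2⟩ := ih
    rcases Finset.mem_union.1 hv with hv | hv
    -- The resting part is reachable in `H` by induction, so `hy` bounds it; this is where the two
    -- bounds support each other.
    · obtain ⟨hst, heq⟩ := step_union_of_mem hd hv hK hcK hs (hy _ h2)
      rw [heq]
      exact ⟨h1.trans (hst.tarReach h1.indep_right h1.card_right), h2⟩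
    · rw [union_comm] at hK
      obtain ⟨hst, heq⟩ := step_union_of_mem hd.symm hv hK hcK hs (hx _ h1)
      rw [heq]
      exact ⟨h1, h2.trans (hst.tarReach h2.indep_right h2.card_right)⟩

/-! ### Attained and saturated pairs of sizes -/

/-- From the part of `A` in the union of `G` and `H`, a set with `x` vertices in `G` and `y`
vertices in `H` can be reached. -/
def Attains (G H : FinGraph V) (A : Finset V) (ℓ x y : ℕ) : Prop :=
  ∃ X Y, X.card = x ∧ Y.card = y ∧ G.TARReach (ℓ - y) (A ∩ G.verts) X ∧
    H.TARReach (ℓ - x) (A ∩ H.verts) Y ∧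
    (G.union H).TARReach ℓ (A ∩ (G.union H).verts) (X ∪ Y)

theorem inter_union_verts (G H : FinGraph V) (A : Finset V) :
    A ∩ (G.union H).verts = (A ∩ G.verts) ∪ (A ∩ H.verts) :=
  Finset.inter_union_distrib_left _ _ _

theorem Attains.symm {x y : ℕ} : G.Attains H A ℓ x y → H.Attains G A ℓ y x := by
  rintro ⟨X, Y, hX, hY, h1, h2, h3⟩
  refine ⟨Y, X, hY, hX, h2, h1, ?_⟩
  rwa [union_comm, Finset.union_comm]

/-- The start of the iteration, at the largest threshold that `A` allows. -/
theorem attains_card (hd : Disjoint G.verts H.verts) (hG : G.IsIndep (A ∩ G.verts))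
    (hH : H.IsIndep (A ∩ H.verts)) :
    G.Attains H A ((A ∩ G.verts).card + (A ∩ H.verts).card)
      (A ∩ G.verts).card (A ∩ H.verts).card := by
  refine ⟨_, _, rfl, rfl, TARReach.refl hG (by omega), TARReach.refl hH (by omega), ?_⟩
  rw [inter_union_verts]
  exact TARReach.refl (isIndep_union hd hG hH) (card_union_of_subset_verts hd hG.1 hH.1).ge

/-- Lets the iteration for a smaller threshold continue from the pair found for the larger one. The
quadratic time bound depends on this. -/
theorem Attains.mono {x y : ℕ} (hk : ℓ ≤ k) : G.Attains H A k x y → G.Attains H A ℓ x y := by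
  rintro ⟨X, Y, hX, hY, h1, h2, h3⟩
  exact ⟨X, Y, hX, hY, h1.mono (by omega), h2.mono (by omega), h3.mono hk⟩

theorem Attains.left_le {x y : ℕ} : G.Attains H A ℓ x y → ℓ - y ≤ (A ∩ G.verts).card := by
  rintro ⟨X, Y, hX, hY, h1, h2, h3⟩
  exact h1.card_left

theorem Attains.add_le {x y : ℕ} (hd : Disjoint G.verts H.verts) :
    G.Attains H A ℓ x y → x + y ≤ (G.union H).verts.card := by
  rintro ⟨X, Y, rfl, rfl, h1, h2, h3⟩
  rw [← card_union_of_subset_verts hd h1.indep_right.1 h2.indep_right.1]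
  exact Finset.card_le_card h3.indep_right.1

theorem Attains.le_ris {x y : ℕ} : G.Attains H A ℓ x y → x ≤ G.RIS A (ℓ - y) := by
  rintro ⟨X, Y, rfl, rfl, h1, h2, h3⟩
  exact card_le_ris h1

/-- Half a round: the `y` tokens in `H` rest while the part in `G` moves to a largest set reachable
at `ℓ - y`. A larger first component only lowers the threshold required in `H`. -/
theorem Attains.step {x y : ℕ} (hd : Disjoint G.verts H.verts) (h : G.Attains H A ℓ x y) :
    G.Attains H A ℓ (G.RIS A (ℓ - y)) y := by
  have hle := h.le_ris
  obtain ⟨X, Y, rfl, rfl, h1, h2, h3⟩ := h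
  obtain ⟨Z, hZ, hc⟩ := exists_card_eq_ris h1.indep_left h1.card_left
  refine ⟨Z, Y, hc, rfl, hZ, h2.mono (by omega), h3.trans ?_⟩
  exact (h1.symm.trans hZ).union_right hd h2.indep_right

/-- The pair `(x, y)` is attained, and neither component can be increased while the other is
kept. -/
structure Saturated (G H : FinGraph V) (A : Finset V) (ℓ x y : ℕ) : Prop where
  attains : G.Attains H A ℓ x y
  left : G.RIS A (ℓ - y) = x
  right : H.RIS A (ℓ - x) = y

/-- Saturation supplies exactly the two size bounds that `TARReach.of_union` asks for. -/
theorem TARReach.of_union_ris (hd : Disjoint G.verts H.verts) {x y : ℕ}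
    (h : G.Saturated H A ℓ x y)
    (hJ : (G.union H).TARReach ℓ (A ∩ (G.union H).verts) J) :
    G.TARReach (ℓ - y) (A ∩ G.verts) (J ∩ G.verts) ∧
      H.TARReach (ℓ - x) (A ∩ H.verts) (J ∩ H.verts) := by
  have e1 : A ∩ (G.union H).verts ∩ G.verts = A ∩ G.verts := by
    rw [inter_union_verts,
      union_inter_verts_left hd Finset.inter_subset_right Finset.inter_subset_right]
  have e2 : A ∩ (G.union H).verts ∩ H.verts = A ∩ H.verts := by
    rw [inter_union_verts, Finset.union_comm,
      union_inter_verts_left hd.symm Finset.inter_subset_right Finset.inter_subset_right]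
  have := TARReach.of_union (x := x) (y := y) hd (by rw [e1]; exact h.attains.left_le)
    (by rw [e2]; exact h.attains.symm.left_le)
    (fun X hX => by rw [e1] at hX; exact h.left ▸ card_le_ris hX)
    (fun Y hY => by rw [e2] at hY; exact h.right ▸ card_le_ris hY) hJ
  rwa [e1, e2] at this

/-- The splitting of reachable sets bounds both parts, and the attained pair meets the bound. -/
theorem Saturated.ris_union (hd : Disjoint G.verts H.verts) {x y : ℕ}
    (h : G.Saturated H A ℓ x y) :
    (G.union H).RIS A ℓ = x + y := by
  have hbound : ∀ J, (G.union H).TARReach ℓ (A ∩ (G.union H).verts) J → J.card ≤ x + y := by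
    intro J hJ
    obtain ⟨h1, h2⟩ := hJ.of_union_ris hd h
    have := card_le_ris h1
    have := card_le_ris h2
    have := card_inter_add_card_inter hd hJ.indep_right.1
    have := h.left
    have := h.right
    omega
  obtain ⟨X, Y, rfl, rfl, h1, h2, h3⟩ := h.attains
  exact ris_eq h3 (card_union_of_subset_verts hd h1.indep_right.1 h2.indep_right.1) hbound

/-- If `A` reaches `B`, each reaches the set witnessing the other's pair, so the pairs dominate each
other. Conversely, `A` moves to its witness, the part in `G` is exchanged, then the part in `H`, and
the resulting witness for `B` moves to `B`. -/
theorem Saturated.tarReach_union_iff (hd : Disjoint G.verts H.verts) {x y x' y' : ℕ}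
    (h : G.Saturated H A ℓ x y) (h' : G.Saturated H B ℓ x' y') :
    (G.union H).TARReach ℓ (A ∩ (G.union H).verts) (B ∩ (G.union H).verts) ↔
      (x = x' ∧ y = y') ∧ G.TARReach (ℓ - y) (A ∩ G.verts) (B ∩ G.verts) ∧
        H.TARReach (ℓ - x) (A ∩ H.verts) (B ∩ H.verts) := by
  have key : ∀ {A B : Finset V} {x y x' y' : ℕ}, G.Saturated H A ℓ x y → G.Saturated H B ℓ x' y' →
      (G.union H).TARReach ℓ (A ∩ (G.union H).verts) (B ∩ (G.union H).verts) →
      x' ≤ x ∧ y' ≤ y := by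
    rintro A B x y _ _ h ⟨⟨X, Y, rfl, rfl, h1, h2, h3⟩, _, _⟩ hr
    obtain ⟨h4, h5⟩ := (hr.trans h3).of_union_ris hd h
    rw [union_inter_verts_left hd h1.indep_right.1 h2.indep_right.1] at h4
    rw [Finset.union_comm, union_inter_verts_left hd.symm h2.indep_right.1 h1.indep_right.1] at h5
    exact ⟨h.left ▸ card_le_ris h4, h.right ▸ card_le_ris h5⟩
  constructor
  · intro hr
    obtain ⟨a1, a2⟩ := key h h' hr
    obtain ⟨b1, b2⟩ := key h' h hr.symm
    refine ⟨⟨by omega, by omega⟩, ?_⟩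
    have := hr.of_union_ris hd h
    rwa [inter_union_verts G H B,
      union_inter_verts_left hd Finset.inter_subset_right Finset.inter_subset_right,
      Finset.union_comm,
      union_inter_verts_left hd.symm Finset.inter_subset_right Finset.inter_subset_right] at this
  · rintro ⟨⟨rfl, rfl⟩, hG, hH⟩
    obtain ⟨X, Y, hX, hY, h1, h2, h3⟩ := h.attains
    obtain ⟨X', Y', hX', hY', h1', h2', h3'⟩ := h'.attains
    -- With `Y` at rest the threshold in `G` is `ℓ - y`, at which `X` returns to the part of `A`,
    -- passes to that of `B`, and goes on to `X'`.
    have e1 : (G.union H).TARReach ℓ (X ∪ Y) (X' ∪ Y) :=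
      TARReach.union_right hd h2.indep_right (by rw [hY]; exact h1.symm.trans (hG.trans h1'))
    have e2 : (G.union H).TARReach ℓ (X' ∪ Y) (X' ∪ Y') :=
      TARReach.union_left hd h1'.indep_right (by rw [hX']; exact h2.symm.trans (hH.trans h2'))
    exact h3.trans (e1.trans (e2.trans h3'.symm))

/-! ### Complete joins -/

theorem join_comm (G H : FinGraph V) : G.join H = H.join G := by
  have : SimpleGraph.fromRel (fun y z => y ∈ G.verts ∧ z ∈ H.verts) =
      SimpleGraph.fromRel (fun y z => y ∈ H.verts ∧ z ∈ G.verts) := by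
    ext y z
    simp only [SimpleGraph.fromRel_adj]
    tauto
  simp only [join, this, sup_comm G.toSimpleGraph, Finset.union_comm G.verts]

theorem IsIndep.join_left (hd : Disjoint G.verts H.verts) (hJ : G.IsIndep J) :
    (G.join H).IsIndep J := by
  refine ⟨hJ.1.trans Finset.subset_union_left, fun u hu v hv huv => ?_⟩
  have hu' := Finset.disjoint_left.1 hd (hJ.1 hu)
  have hv' := Finset.disjoint_left.1 hd (hJ.1 hv)
  rintro ((ha | ha) | ⟨_, ha | ha⟩)
  · exact hJ.2 hu hv huv ha
  · exact hu' (H.mem_of_adj _ _ ha)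
  · exact hv' ha.2
  · exact hu' ha.2

theorem IsIndep.of_join (hJ : (G.join H).IsIndep J) (hG : J ⊆ G.verts) : G.IsIndep J :=
  ⟨hG, fun _ hu _ hv huv ha => hJ.2 hu hv huv (Or.inl (Or.inl ha))⟩

/-- A vertex of `G` is adjacent to all of `H`, so one vertex decides the side of the whole set. -/
theorem IsIndep.subset_of_join {v : V} (hd : Disjoint G.verts H.verts)
    (hJ : (G.join H).IsIndep J) (hv : v ∈ J) (hvG : v ∈ G.verts) : J ⊆ G.verts := by
  intro w hw
  rcases Finset.mem_union.1 (hJ.1 hw) with h | h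
  · exact h
  · have hne : v ≠ w := by rintro rfl; exact Finset.disjoint_left.1 hd hvG h
    exact absurd (Or.inr ⟨hne, Or.inl ⟨hvG, h⟩⟩) (hJ.2 hv hw hne)

theorem IsIndep.subset_or_subset_of_join (hd : Disjoint G.verts H.verts)
    (hJ : (G.join H).IsIndep J) : J ⊆ G.verts ∨ J ⊆ H.verts := by
  by_cases h : J ⊆ H.verts
  · exact Or.inr h
  · obtain ⟨v, hv, hvH⟩ := Finset.not_subset.1 h
    exact Or.inl (hJ.subset_of_join hd hv ((Finset.mem_union.1 (hJ.1 hv)).resolve_right hvH))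

/-- Changing sides would require passing through the empty set, which a positive threshold forbids.
-/
theorem tarReach_join_iff (hd : Disjoint G.verts H.verts) (hℓ : 1 ≤ ℓ) (hI : I ⊆ G.verts) :
    (G.join H).TARReach ℓ I J ↔ G.TARReach ℓ I J := by
  constructor
  · intro h
    rw [tarReach_iff] at h
    obtain ⟨h1, h2, h3⟩ := h
    induction h3 with
    | refl => exact TARReach.refl (h1.of_join hI) h2
    | @tail J K _ hs ih =>
      obtain ⟨hK, hc, v, hv, hs⟩ := hs
      have hJ := ih.indep_right
      have hKG : K ⊆ G.verts := by
        -- After an addition, an old vertex still pins the set to `G`; after a removal, the set is a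
        -- subset of the old one.
        rcases hs with rfl | rfl
        · obtain ⟨w, hw⟩ := Finset.card_pos.1 (hℓ.trans ih.card_right)
          exact hK.subset_of_join hd (Finset.mem_insert_of_mem hw) (hJ.1 hw)
        · exact (Finset.subset_insert _ _).trans hJ.1
      refine ih.trans (Step.tarReach hJ ih.card_right ⟨hK.of_join hKG, hc, v, ?_, hs⟩)
      rcases hs with rfl | rfl
      · exact hKG (Finset.mem_insert_self _ _)
      · exact hJ.1 (Finset.mem_insert_self _ _)
  · intro h
    rw [tarReach_iff] at h ⊢
    exact ⟨h.1.join_left hd, h.2.1, Relation.ReflTransGen.mono (r := G.Step ℓ)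
      (fun _ _ hs => ⟨hs.1.join_left hd, hs.2.1, hs.2.2.imp
        fun _ hv => ⟨Finset.mem_union_left _ hv.1, hv.2⟩⟩) _ _ h.2.2⟩

theorem inter_join_verts (G H : FinGraph V) (A : Finset V) :
    A ∩ (G.join H).verts = (A ∩ G.verts) ∪ (A ∩ H.verts) :=
  Finset.inter_union_distrib_left _ _ _

theorem inter_right_eq_empty_of_join (hd : Disjoint G.verts H.verts)
    (hA : (G.join H).IsIndep (A ∩ (G.join H).verts)) (hne : (A ∩ G.verts).Nonempty) :
    A ∩ H.verts = ∅ := by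
  obtain ⟨v, hv⟩ := hne
  rw [inter_join_verts] at hA
  have hs := hA.subset_of_join hd (Finset.mem_union_left _ hv) (Finset.mem_inter.1 hv).2
  have := (Finset.union_subset_iff.1 hs).2
  rw [← Finset.subset_empty]
  exact (Finset.subset_inter this Finset.inter_subset_right).trans
    (Finset.disjoint_iff_inter_eq_empty.1 hd).subset

theorem inter_join_verts_of_empty (h : A ∩ H.verts = ∅) :
    A ∩ (G.join H).verts = A ∩ G.verts := by
  rw [inter_join_verts, h, Finset.union_empty]

theorem ris_join_of_pos (hd : Disjoint G.verts H.verts) (hℓ : 1 ≤ ℓ) (h : A ∩ H.verts = ∅) :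
    (G.join H).RIS A ℓ = G.RIS A ℓ := by
  simp only [RIS, inter_join_verts_of_empty h, tarReach_join_iff hd hℓ Finset.inter_subset_right]

theorem card_le_ris_zero (hA : G.IsIndep (A ∩ G.verts)) (hJ : G.IsIndep J) :
    J.card ≤ G.RIS A 0 :=
  card_le_ris (tarReach_zero hA hJ)

/-- At threshold `0` the RIS values are independence numbers, and each independent set of a join
lies on one side. -/
theorem ris_join_zero (hd : Disjoint G.verts H.verts)
    (hA : (G.join H).IsIndep (A ∩ (G.join H).verts)) :
    (G.join H).RIS A 0 = max (G.RIS A 0) (H.RIS A 0) := by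
  have hAG : G.IsIndep (A ∩ G.verts) :=
    (hA.mono (Finset.inter_subset_inter_left Finset.subset_union_left)).of_join
      Finset.inter_subset_right
  have hAH : H.IsIndep (A ∩ H.verts) := by
    rw [join_comm] at hA
    exact (hA.mono (Finset.inter_subset_inter_left Finset.subset_union_left)).of_join
      Finset.inter_subset_right
  apply le_antisymm
  · obtain ⟨J, hJ, hc⟩ := exists_card_eq_ris hA (Nat.zero_le _)
    rw [← hc]
    rcases hJ.indep_right.subset_or_subset_of_join hd with h | h
    · exact le_max_of_le_left (card_le_ris_zero hAG (hJ.indep_right.of_join h))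
    · have := hJ.indep_right
      rw [join_comm] at this
      exact le_max_of_le_right (card_le_ris_zero hAH (this.of_join h))
  · apply max_le
    · obtain ⟨J, hJ, hc⟩ := exists_card_eq_ris hAG (Nat.zero_le _)
      rw [← hc]
      exact card_le_ris_zero hA (hJ.indep_right.join_left hd)
    · obtain ⟨J, hJ, hc⟩ := exists_card_eq_ris hAH (Nat.zero_le _)
      rw [← hc]
      refine card_le_ris_zero hA ?_
      rw [join_comm]
      exact hJ.indep_right.join_left hd.symm

end FinGraph

namespace Cotree

variable {V : Type*} {S T : Cotree V}

/-! ### The preorder numbering of the nodes -/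

theorem getElem?_nodes_zero (T : Cotree V) : T.nodes[0]? = some T := by
  cases T <;> rfl

/-- In preorder a subtree occupies a contiguous block that starts at its root, so positions add up.
-/
theorem getElem?_nodes_add {i j : ℕ} {S' : Cotree V} (h : T.nodes[i]? = some S)
    (h' : S.nodes[j]? = some S') : T.nodes[i + j]? = some S' := by
  have key : ∀ (T l r : Cotree V) (i : ℕ), T.nodes = T :: (l.nodes ++ r.nodes) →
      (∀ i, l.nodes[i]? = some S → l.nodes[i + j]? = some S') →
      (∀ i, r.nodes[i]? = some S → r.nodes[i + j]? = some S') →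
      T.nodes[i]? = some S → T.nodes[i + j]? = some S' := by
    intro T l r i hT ihl ihr h
    cases i with
    | zero =>
      rw [getElem?_nodes_zero, Option.some_inj] at h
      subst h
      rwa [Nat.zero_add]
    | succ i =>
      rw [hT, List.getElem?_cons_succ] at h
      rw [hT, Nat.add_right_comm, List.getElem?_cons_succ]
      rcases lt_or_ge i l.nodes.length with hi | hi
      · rw [List.getElem?_append_left hi] at h
        have := ihl i h
        rwa [List.getElem?_append_left (List.getElem?_eq_some_iff.1 this).1]
      · rw [List.getElem?_append_right hi] at h
        have := ihr _ h
        rw [List.getElem?_append_right (by omega)]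
        rwa [Nat.sub_add_comm hi]
  induction T generalizing i with
  | leaf H =>
    cases i with
    | zero =>
      rw [getElem?_nodes_zero, Option.some_inj] at h
      subst h
      rwa [Nat.zero_add]
    | succ i => simp [nodes] at h
  | union l r ihl ihr => exact key _ l r i rfl (fun _ => ihl) (fun _ => ihr) h
  | join l r ihl ihr => exact key _ l r i rfl (fun _ => ihl) (fun _ => ihr) h

theorem getElem?_nodes_left {i : ℕ} {l r : Cotree V} (h : T.nodes[i]? = some S)
    (hS : S.nodes = S :: (l.nodes ++ r.nodes)) : T.nodes[i + 1]? = some l := by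
  refine getElem?_nodes_add h ?_
  rw [hS, List.getElem?_cons_succ,
    List.getElem?_append_left (List.getElem?_eq_some_iff.1 (getElem?_nodes_zero l)).1,
    getElem?_nodes_zero]

theorem getElem?_nodes_right {i : ℕ} {l r : Cotree V} (h : T.nodes[i]? = some S)
    (hS : S.nodes = S :: (l.nodes ++ r.nodes)) :
    T.nodes[i + 1 + l.nodes.length]? = some r := by
  rw [Nat.add_assoc, Nat.add_comm 1]
  refine getElem?_nodes_add h ?_
  rw [hS, List.getElem?_cons_succ, List.getElem?_append_right le_rfl, Nat.sub_self,
    getElem?_nodes_zero]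

variable [DecidableEq V]

/-! ### Subtrees, leaves and the number of nodes -/

theorem WellFormed.of_mem (hT : T.WellFormed) (h : S ∈ T.nodes) : S.WellFormed := by
  induction T with
  | leaf H => rw [List.mem_singleton.1 h]; exact hT
  | union l r ihl ihr =>
    rcases List.mem_cons.1 h with rfl | h
    · exact hT
    · exact (List.mem_append.1 h).elim (ihl hT.1) (ihr hT.2.1)
  | join l r ihl ihr =>
    rcases List.mem_cons.1 h with rfl | h
    · exact hT
    · exact (List.mem_append.1 h).elim (ihl hT.1) (ihr hT.2.1)

theorem graph_le_of_mem (h : S ∈ T.nodes) :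
    S.graph.toSimpleGraph ≤ T.graph.toSimpleGraph ∧ S.graph.verts ⊆ T.graph.verts := by
  induction T with
  | leaf H => rw [List.mem_singleton.1 h]; exact ⟨le_rfl, Finset.Subset.refl _⟩
  | union l r ihl ihr =>
    rcases List.mem_cons.1 h with rfl | h
    · exact ⟨le_rfl, Finset.Subset.refl _⟩
    rcases List.mem_append.1 h with h | h
    · exact ⟨(ihl h).1.trans le_sup_left, (ihl h).2.trans Finset.subset_union_left⟩
    · exact ⟨(ihr h).1.trans le_sup_right, (ihr h).2.trans Finset.subset_union_right⟩
  | join l r ihl ihr =>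
    rcases List.mem_cons.1 h with rfl | h
    · exact ⟨le_rfl, Finset.Subset.refl _⟩
    rcases List.mem_append.1 h with h | h
    · exact ⟨(ihl h).1.trans (le_sup_left.trans le_sup_left),
        (ihl h).2.trans Finset.subset_union_left⟩
    · exact ⟨(ihr h).1.trans (le_sup_right.trans le_sup_left),
        (ihr h).2.trans Finset.subset_union_right⟩

theorem isIndep_inter_of_mem {A : Finset V} (hA : T.graph.toSimpleGraph.IsIndepSet (A : Set V))
    (h : S ∈ T.nodes) : S.graph.IsIndep (A ∩ S.graph.verts) :=
  ⟨Finset.inter_subset_right, fun _ hu _ hv huv ha =>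
    hA (Finset.mem_inter.1 hu).1 (Finset.mem_inter.1 hv).1 huv ((graph_le_of_mem h).1 ha)⟩

/-- A binary tree with `L` leaves has `2 * L - 1` nodes, and the leaves carry disjoint nonempty
vertex sets. The strict inequality absorbs the extra inner node in the induction. -/
theorem WellFormed.length_nodes_lt (hT : T.WellFormed) :
    T.nodes.length < 2 * T.graph.verts.card := by
  induction T with
  | leaf H =>
    have := Finset.card_pos.2 hT
    simp only [nodes, graph, List.length_singleton]
    omega
  | union l r ihl ihr =>
    have := ihl hT.1
    have := ihr hT.2.1
    have hc : (union l r).graph.verts.card = l.graph.verts.card + r.graph.verts.card :=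
      Finset.card_union_of_disjoint hT.2.2
    simp only [nodes, List.length_cons, List.length_append, hc]
    omega
  | join l r ihl ihr =>
    have := ihl hT.1
    have := ihr hT.2.1
    have hc : (join l r).graph.verts.card = l.graph.verts.card + r.graph.verts.card :=
      Finset.card_union_of_disjoint hT.2.2
    simp only [nodes, List.length_cons, List.length_append, hc]
    omega

theorem exists_leaf_of_mem_verts {v : V} (hv : v ∈ T.graph.verts) :
    ∃ H, leaf H ∈ T.nodes ∧ v ∈ H.verts := by
  induction T with
  | leaf H => exact ⟨H, List.mem_singleton.2 rfl, hv⟩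
  | union l r ihl ihr =>
    rcases Finset.mem_union.1 hv with h | h
    · obtain ⟨H, hH, h⟩ := ihl h
      exact ⟨H, List.mem_cons_of_mem _ (List.mem_append_left _ hH), h⟩
    · obtain ⟨H, hH, h⟩ := ihr h
      exact ⟨H, List.mem_cons_of_mem _ (List.mem_append_right _ hH), h⟩
  | join l r ihl ihr =>
    rcases Finset.mem_union.1 hv with h | h
    · obtain ⟨H, hH, h⟩ := ihl h
      exact ⟨H, List.mem_cons_of_mem _ (List.mem_append_left _ hH), h⟩
    · obtain ⟨H, hH, h⟩ := ihr h
      exact ⟨H, List.mem_cons_of_mem _ (List.mem_append_right _ hH), h⟩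

end Cotree

/-! ### Running times and postconditions of programs -/

/-- Started with memory `m`, the program `p` halts after at most `t` steps with a memory that
satisfies `Q`. -/
def Runs (p : Prog) (m : Mem) (t : ℕ) (Q : Mem → Prop) : Prop :=
  ∃ s m', Exec p m s m' ∧ s ≤ t ∧ Q m'

namespace Runs

variable {p q : Prog} {b : Expr} {m : Mem} {t t' : ℕ} {Q R : Mem → Prop}

theorem mono (h : Runs p m t Q) (ht : t ≤ t') (hQ : ∀ m', Q m' → R m') : Runs p m t' R := by
  obtain ⟨s, m', he, hs, hm⟩ := h
  exact ⟨s, m', he, hs.trans ht, hQ _ hm⟩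

theorem seq (h : Runs p m t Q) (h' : ∀ m', Q m' → Runs q m' t' R) :
    Runs (Prog.seq p q) m (t + t') R := by
  obtain ⟨s, m', he, hs, hm⟩ := h
  obtain ⟨s', m'', he', hs', hm'⟩ := h' m' hm
  exact ⟨s + s', m'', he.seq he', by omega, hm'⟩

theorem ite_pos (hb : b.eval m ≠ 0) (h : Runs p m t Q) :
    Runs (Prog.ite b p q) m (1 + b.cost + t) Q := by
  obtain ⟨s, m', he, hs, hm⟩ := h
  exact ⟨_, m', he.ite_pos hb, by omega, hm⟩

theorem ite_neg (hb : b.eval m = 0) (h : Runs q m t Q) :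
    Runs (Prog.ite b p q) m (1 + b.cost + t) Q := by
  obtain ⟨s, m', he, hs, hm⟩ := h
  exact ⟨_, m', he.ite_neg hb, by omega, hm⟩

/-- A loop whose body takes at most `d` steps and decreases the counter `s` of the invariant. -/
theorem loop {Inv : ℕ → Mem → Prop} (d : ℕ)
    (h : ∀ s m, Inv s m → b.eval m ≠ 0 → ∃ s' < s, Runs p m d (Inv s')) {s : ℕ} (hm : Inv s m) :
    Runs (Prog.loop b p) m (s * (1 + b.cost + d) + (1 + b.cost))
      (fun m' => b.eval m' = 0 ∧ ∃ s', Inv s' m') := by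
  induction s using Nat.strong_induction_on generalizing m with
  | _ s ih =>
    by_cases hb : b.eval m = 0
    · exact ⟨_, m, Exec.loop_done hb, by omega, hb, s, hm⟩
    · obtain ⟨s', hs', t, m', he, ht, hm'⟩ := h s m hm hb
      obtain ⟨t', m'', he', ht', hm''⟩ := ih s' hs' hm'
      refine ⟨_, m'', he.loop_step hb he', ?_, hm''⟩
      -- The round just executed is paid for by the decrease of the counter by at least one.
      have : (s' + 1) * (1 + b.cost + d) ≤ s * (1 + b.cost + d) := Nat.mul_le_mul_right _ hs'
      rw [Nat.succ_mul] at this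
      omega

end Runs

/-- `m' a = m a` for all arrays that are not in the list. -/
def AgreesOff (L : List ℕ) (m m' : Mem) : Prop := ∀ a, a ∉ L → m' a = m a

/-- The content of the first cell of an array, used as a variable. -/
def Expr.var (a : ℕ) : Expr := Expr.read a (Expr.const 0)

/-! ### Loop-free programs and the filling of table rows -/

namespace Prog

/-- There is no loop in the program. -/
def LoopFree : Prog → Prop
  | skip => True
  | write _ _ _ => True
  | seq p q => p.LoopFree ∧ q.LoopFree
  | ite _ p q => p.LoopFree ∧ q.LoopFree
  | loop _ _ => False

/-- The memory after a run of a loop-free program. -/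
def run : Prog → Mem → Mem
  | skip, m => m
  | write a i x, m => Function.update m a (Function.update (m a) (i.eval m) (x.eval m))
  | seq p q, m => q.run (p.run m)
  | ite b p q, m => if b.eval m = 0 then q.run m else p.run m
  | loop _ _, m => m

/-- A bound for the running time of a loop-free program. -/
def time : Prog → ℕ
  | skip => 1
  | write _ i x => 1 + i.cost + x.cost
  | seq p q => p.time + q.time
  | ite b p q => 1 + b.cost + (p.time + q.time)
  | loop _ _ => 0

/-- Reduces loop-free code to unfolding `run` and to a numeral for the time; only loops need
invariants. -/
theorem LoopFree.runs {p : Prog} (h : p.LoopFree) (m : Mem) :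
    Runs p m p.time (fun m' => m' = p.run m) := by
  induction p generalizing m with
  | skip => exact ⟨1, m, Exec.skip m, le_rfl, rfl⟩
  | write a i x => exact ⟨_, _, Exec.write a i x m, le_rfl, rfl⟩
  | seq p q ihp ihq => exact (ihp h.1 m).seq fun m' hm' => hm' ▸ ihq h.2 m'
  | ite b p q ihp ihq =>
    by_cases hb : b.eval m = 0
    · refine (Runs.ite_neg hb (ihq h.2 m)).mono ?_ fun m' hm' => ?_
      · simp only [time]; omega
      · simpa only [run, if_pos hb] using hm'
    · refine (Runs.ite_pos hb (ihp h.1 m)).mono ?_ fun m' hm' => ?_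
      · simp only [time]; omega
      · simpa only [run, if_neg hb] using hm'
  | loop b p => exact h.elim

/-- Assignment to the first cell of an array. -/
def assign (a : ℕ) (x : Expr) : Prog := write a (Expr.const 0) x

/-- Fill the cells of array `a` from `base` on with the values `val`, where the variable `e` runs
down to `0`. -/
def fill (a e : ℕ) (base val : Expr) : Prog :=
  loop (Expr.var e) (seq (assign e (Expr.sub (Expr.var e) (Expr.const 1)))
    (write a (Expr.add base (Expr.var e)) val))

/-- The expressions must evaluate correctly in every memory met on the way, where only the counter
and the segment from `r` to `r + c` may have changed. So `val` may read the array being filled,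
outside that segment. -/
theorem runs_fill {a e : ℕ} {base val : Expr} {m : Mem} {r c : ℕ} {f : ℕ → ℕ} (hae : a ≠ e)
    (hc : m e 0 = c)
    (h : ∀ m' ℓ, ℓ < c → m' e 0 = ℓ → AgreesOff [a, e] m m' →
      (∀ j, j < r ∨ r + c ≤ j → m' a j = m a j) → base.eval m' = r ∧ val.eval m' = f ℓ) :
    Runs (fill a e base val) m (c * (10 + base.cost + val.cost + 3) + 3) (fun m' =>
      AgreesOff [a, e] m m' ∧ (∀ j, j < r ∨ r + c ≤ j → m' a j = m a j) ∧
        ∀ ℓ < c, m' a (r + ℓ) = f ℓ) := by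
  have hbody : (seq (assign e (Expr.sub (Expr.var e) (Expr.const 1)))
      (write a (Expr.add base (Expr.var e)) val)).time = 10 + base.cost + val.cost := by
    simp only [time, assign, Expr.var, Expr.cost]; omega
  have key := Runs.loop (b := Expr.var e) (m := m)
    (p := seq (assign e (Expr.sub (Expr.var e) (Expr.const 1)))
      (write a (Expr.add base (Expr.var e)) val))
    (Inv := fun s m' => m' e 0 = s ∧ s ≤ c ∧ AgreesOff [a, e] m m' ∧
      (∀ j, j < r ∨ r + c ≤ j → m' a j = m a j) ∧ ∀ ℓ, s ≤ ℓ → ℓ < c → m' a (r + ℓ) = f ℓ)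
    (10 + base.cost + val.cost) ?_ (s := c) ⟨hc, le_rfl, fun _ _ => rfl, fun _ _ => rfl, by omega⟩
  · refine key.mono (by simp only [Expr.var, Expr.cost]; rw [Nat.add_comm (1 + 2)]) ?_
    rintro m' ⟨h0, s, h1, h2, h3, h4, h5⟩
    refine ⟨h3, h4, fun ℓ hℓ => h5 ℓ ?_ hℓ⟩
    simp only [Expr.var, Expr.eval, h1] at h0
    omega
  · rintro s m' ⟨h1, h2, h3, h4, h5⟩ hb
    simp only [Expr.var, Expr.eval, h1] at hb
    refine ⟨s - 1, by omega, ?_⟩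
    rw [← hbody]
    refine (LoopFree.runs (by simp [LoopFree, assign]) m').mono le_rfl ?_
    rintro _ rfl
    simp only [run, assign, Expr.var]
    set m₁ : Mem := Function.update m' e (Function.update (m' e) ((Expr.const 0).eval m')
      (((Expr.read e (Expr.const 0)).sub (Expr.const 1)).eval m')) with hm₁
    have e1 : m₁ e 0 = s - 1 := by simp [m₁, Expr.eval, h1]
    have e2 : AgreesOff [e] m' m₁ := fun a' ha' => by
      simp only [List.mem_singleton] at ha'
      simp [m₁, Function.update_of_ne ha']
    have e3 : m₁ a = m' a := e2 a (by simpa using hae)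
    -- The counter is lowered before the write, so a start at `c` fills exactly the offsets below
    -- `c`.
    obtain ⟨hbase, hval⟩ := h m₁ (s - 1) (by omega) e1 (fun a' ha' => by
      rw [← h3 a' ha']
      exact e2 a' (by simp only [List.mem_cons, not_or] at ha'; simpa using ha'.2.1))
      (fun j hj => by rw [e3, h4 j hj])
    simp only [Expr.eval, hbase, hval, e1]
    refine ⟨by rw [Function.update_of_ne hae.symm, e1], by omega, fun a' ha' => ?_, fun j hj => ?_,
      fun ℓ hℓ hc' => ?_⟩
    · have ha'' := ha'
      simp only [List.mem_cons, not_or] at ha''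
      rw [Function.update_of_ne ha''.1, e2 a' (by simpa using ha''.2.1), h3 a' ha']
    · rw [Function.update_self, Function.update_of_ne (by omega), e3, h4 j hj]
    · rw [Function.update_self, Function.update_apply]
      split_ifs with hc''
      · congr 1; omega
      · rw [e3]; exact h5 ℓ (by omega) hc'

end Prog

open ISR.Prog ISR.Expr ISR.FinGraph

/-! ### The tables -/

section Rows

variable {n : ℕ} {A B S : Finset (Fin n)} {G H : FinGraph (Fin n)} {m m' : Mem} {i j k : ℕ}

/-- Cell `i` of array `c` and row `i` of the table `t` contain the values for the graph `H`. -/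
structure RisRow (t c : ℕ) (S : Finset (Fin n)) (m : Mem) (i : ℕ) (H : FinGraph (Fin n)) :
    Prop where
  card : m c i = (S ∩ H.verts).card
  ris : ∀ ℓ ≤ (S ∩ H.verts).card, m t (i * (n + 1) + ℓ) = H.RIS S ℓ

open Classical in
/-- The entries for node `i`, with graph `H`, are correct. -/
structure RowOK (A B : Finset (Fin n)) (m : Mem) (i : ℕ) (H : FinGraph (Fin n)) : Prop where
  risA : RisRow 9 13 A m i H
  risB : RisRow 10 14 B m i H
  reach : ∀ ℓ ≤ min (A ∩ H.verts).card (B ∩ H.verts).card,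
    m 11 (i * (n + 1) + ℓ) = if H.TARReach ℓ (A ∩ H.verts) (B ∩ H.verts) then 1 else 0

/-- Among the arrays `0, …, 15`, only the entries for node `i` differ. -/
structure Frame (n i : ℕ) (m m' : Mem) : Prop where
  off : ∀ a < 16, a ∉ [9, 10, 11, 13, 14] → m' a = m a
  table : ∀ a ∈ [9, 10, 11], ∀ j, j < i * (n + 1) ∨ (i + 1) * (n + 1) ≤ j → m' a j = m a j
  count : ∀ a ∈ [13, 14], ∀ j ≠ i, m' a j = m a j

theorem card_inter_le (S T : Finset (Fin n)) : (S ∩ T).card ≤ n := by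
  simpa using Finset.card_le_univ (S ∩ T)

theorem card_inter_add_le (hd : Disjoint G.verts H.verts) (S : Finset (Fin n)) :
    (S ∩ G.verts).card + (S ∩ H.verts).card ≤ n := by
  rw [← Finset.card_union_of_disjoint
    (hd.mono Finset.inter_subset_right Finset.inter_subset_right)]
  simpa using Finset.card_le_univ ((S ∩ G.verts) ∪ (S ∩ H.verts))

/-- Relevant thresholds are at most `n`, so rows of width `n + 1` do not overlap. -/
theorem cell_lt {ℓ : ℕ} (hij : i < j) (hℓ : ℓ ≤ n) :
    i * (n + 1) + ℓ < j * (n + 1) := by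
  have : (i + 1) * (n + 1) ≤ j * (n + 1) := Nat.mul_le_mul_right _ hij
  rw [Nat.succ_mul] at this
  omega

theorem row_le (hij : i < j) : i * (n + 1) + (n + 1) ≤ j * (n + 1) := by
  have : (i + 1) * (n + 1) ≤ j * (n + 1) := Nat.mul_le_mul_right _ hij
  rwa [Nat.succ_mul] at this

theorem RisRow.congr {t c : ℕ} (h : RisRow t c S m i H) (hc : m' c i = m c i)
    (ht : ∀ ℓ ≤ n, m' t (i * (n + 1) + ℓ) = m t (i * (n + 1) + ℓ)) : RisRow t c S m' i H :=
  ⟨hc.trans h.card, fun ℓ hℓ => (ht ℓ (hℓ.trans (card_inter_le _ _))).trans (h.ris ℓ hℓ)⟩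

theorem Frame.cell {a ℓ : ℕ} (h : Frame n i m m') (ha : a ∈ [9, 10, 11]) (hij : j ≠ i)
    (hℓ : ℓ ≤ n) : m' a (j * (n + 1) + ℓ) = m a (j * (n + 1) + ℓ) := by
  refine h.table a ha _ ?_
  rcases lt_or_gt_of_ne hij with h | h
  · exact Or.inl (cell_lt h hℓ)
  · exact Or.inr ((Nat.mul_le_mul_right _ h).trans (Nat.le_add_right _ _))

theorem RowOK.of_frame (h : RowOK A B m j H) (hf : Frame n i m m') (hij : j ≠ i) :
    RowOK A B m' j H where
  risA := h.risA.congr (hf.count 13 (by simp) j hij) fun _ => hf.cell (by simp) hij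
  risB := h.risB.congr (hf.count 14 (by simp) j hij) fun _ => hf.cell (by simp) hij
  reach := fun ℓ hℓ => by
    rw [hf.cell (by simp) hij (hℓ.trans ((min_le_left _ _).trans (card_inter_le _ _)))]
    exact h.reach ℓ hℓ

theorem Frame.trans {m'' : Mem} (h : Frame n i m m') (h' : Frame n i m' m'') :
    Frame n i m m'' where
  off := fun a ha ha' => (h'.off a ha ha').trans (h.off a ha ha')
  table := fun a ha j hj => (h'.table a ha j hj).trans (h.table a ha j hj)
  count := fun a ha j hj => (h'.count a ha j hj).trans (h.count a ha j hj)

end Rows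

/-! ### Union nodes: the largest reachable sizes

Variables: `15` the node, `16`, `17`, `18` the first cells of the rows of the node and its
children. -/

/-- One round of the computation for a union node. The pair in the variables `19` and `20` is
replaced by a larger one, or recorded if it is saturated for the threshold `ℓ`, where `ℓ + 1` is the
content of variable `21`. -/
def unionRisBody (t xs ys : ℕ) : Prog :=
  seq (assign 22 (read t (add (var 17) (sub (sub (var 21) (const 1)) (var 20)))))
  (seq (assign 23 (read t (add (var 18) (sub (sub (var 21) (const 1)) (var 22)))))
  (ite (add (sub (var 22) (var 19)) (sub (var 23) (var 20)))
    (seq (assign 19 (var 22)) (assign 20 (var 23)))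
    (seq (assign 21 (sub (var 21) (const 1)))
    (seq (write t (add (var 16) (var 21)) (add (var 19) (var 20)))
    (seq (write xs (var 21) (var 19)) (write ys (var 21) (var 20)))))))

/-- The computation of row `i` of the table `t` for a union node `i`. -/
def unionRis (t c xs ys : ℕ) : Prog :=
  seq (seq (assign 19 (read c (read 5 (var 15))))
    (seq (assign 20 (read c (read 6 (var 15))))
    (assign 21 (add (add (var 19) (var 20)) (const 1)))))
  (Prog.loop (var 21) (unionRisBody t xs ys))

/-- The numbers of the arrays for the first and for the second set. -/
def IsSide (t c xs ys : ℕ) : Prop :=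
  (t = 9 ∧ c = 13 ∧ xs = 24 ∧ ys = 26) ∨ (t = 10 ∧ c = 14 ∧ xs = 25 ∧ ys = 27)

theorem unionRisBody_run_of_ne {t xs ys x y x' y' : ℕ} {m : Mem}
    (hx : m 19 0 = x) (hy : m 20 0 = y)
    (hx' : m t (m 17 0 + (m 21 0 - 1 - y)) = x')
    (hy' : m t (m 18 0 + (m 21 0 - 1 - x')) = y') (ht : t < 16)
    (hne : x' - x + (y' - y) ≠ 0) :
    (unionRisBody t xs ys).run m 19 0 = x' ∧ (unionRisBody t xs ys).run m 20 0 = y' ∧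
      AgreesOff [19, 20, 22, 23] m ((unionRisBody t xs ys).run m) := by
  have h22 : 22 ≠ t := by omega
  have h23 : 23 ≠ t := by omega
  have e : (unionRisBody t xs ys).run m =
      Function.update (Function.update (Function.update (Function.update m
        22 (Function.update (m 22) 0 x')) 23 (Function.update (m 23) 0 y'))
        19 (Function.update (m 19) 0 x')) 20 (Function.update (m 20) 0 y') := by
    simp [unionRisBody, run, assign, var, eval, hx, hy, hx', hy', h22.symm]
    omega
  rw [e]
  refine ⟨by simp, by simp, fun a ha => ?_⟩
  simp only [List.mem_cons, not_or] at ha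
  simp [ha]

theorem unionRisBody_run_of_eq {t c xs ys x y : ℕ} {m : Mem} (hs : IsSide t c xs ys)
    (hx : m 19 0 = x) (hy : m 20 0 = y)
    (hx' : m t (m 17 0 + (m 21 0 - 1 - y)) = x)
    (hy' : m t (m 18 0 + (m 21 0 - 1 - x)) = y) :
    (unionRisBody t xs ys).run m =
      Function.update (Function.update (Function.update (Function.update
        (Function.update (Function.update m
        22 (Function.update (m 22) 0 x)) 23 (Function.update (m 23) 0 y))
        21 (Function.update (m 21) 0 (m 21 0 - 1)))
        t (Function.update (m t) (m 16 0 + (m 21 0 - 1)) (x + y)))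
        xs (Function.update (m xs) (m 21 0 - 1) x))
        ys (Function.update (m ys) (m 21 0 - 1) y) := by
  rcases hs with ⟨rfl, rfl, rfl, rfl⟩ | ⟨rfl, rfl, rfl, rfl⟩ <;>
  simp [unionRisBody, run, assign, var, eval, hx, hy, hx', hy']

section UnionNodes

variable {n : ℕ} {A B S : Finset (Fin n)} {G H : FinGraph (Fin n)} {m : Mem} {i j k : ℕ}

/-- The assertions between the rounds of the computation for a union node; `s` bounds the number of
remaining rounds. -/
structure UnionRisInv (n i t xs ys : ℕ) (S : Finset (Fin n)) (G H : FinGraph (Fin n))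
    (m : Mem) (s : ℕ) (m' : Mem) : Prop where
  off : AgreesOff [t, 19, 20, 21, 22, 23, xs, ys] m m'
  table : ∀ j, j < i * (n + 1) ∨ (i + 1) * (n + 1) ≤ j → m' t j = m t j
  le : m' 21 0 ≤ (S ∩ G.verts).card + (S ∩ H.verts).card + 1
  rounds : m' 21 0 + n = s + (m' 19 0 + m' 20 0)
  attains : G.Attains H S (m' 21 0 - 1) (m' 19 0) (m' 20 0)
  done : ∀ ℓ, m' 21 0 ≤ ℓ → ℓ ≤ (S ∩ G.verts).card + (S ∩ H.verts).card →
    m' t (i * (n + 1) + ℓ) = (G.union H).RIS S ℓ ∧ G.Saturated H S ℓ (m' xs ℓ) (m' ys ℓ)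

/-- The potential is the counter in variable `21` plus `n` minus the sum of the pair. A round either
enlarges the pair or records it and lowers the counter. -/
theorem UnionRisInv.body {t c xs ys s : ℕ} {m' : Mem} (hs : IsSide t c xs ys)
    (hd : Disjoint G.verts H.verts) (hij : i < j) (hik : i < k)
    (h16 : m 16 0 = i * (n + 1)) (h17 : m 17 0 = j * (n + 1)) (h18 : m 18 0 = k * (n + 1))
    (hl : RisRow t c S m j G) (hr : RisRow t c S m k H)
    (h : UnionRisInv n i t xs ys S G H m s m') (hpos : m' 21 0 ≠ 0) :
    ∃ s' < s, UnionRisInv n i t xs ys S G H m s' ((unionRisBody t xs ys).run m') := by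
  have hn := card_inter_add_le hd S
  -- The children's rows are in the table being written; having larger numbers, they lie beyond row
  -- `i` and are intact.
  have hrow : ∀ q ℓ, i < q → ℓ ≤ n → m' t (q * (n + 1) + ℓ) = m t (q * (n + 1) + ℓ) :=
    fun q ℓ hq hℓ => h.table _ (Or.inr ((Nat.mul_le_mul_right _ hq).trans (Nat.le_add_right _ _)))
  have g16 : m' 16 0 = i * (n + 1) := by
    rw [← h16, h.off 16 (by rcases hs with ⟨rfl, rfl, rfl, rfl⟩ | ⟨rfl, rfl, rfl, rfl⟩ <;> simp)]
  have g17 : m' 17 0 = j * (n + 1) := by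
    rw [← h17, h.off 17 (by rcases hs with ⟨rfl, rfl, rfl, rfl⟩ | ⟨rfl, rfl, rfl, rfl⟩ <;> simp)]
  have g18 : m' 18 0 = k * (n + 1) := by
    rw [← h18, h.off 18 (by rcases hs with ⟨rfl, rfl, rfl, rfl⟩ | ⟨rfl, rfl, rfl, rfl⟩ <;> simp)]
  obtain ⟨e, he⟩ : ∃ e, m' 21 0 = e + 1 := ⟨m' 21 0 - 1, by omega⟩
  obtain ⟨x, hx⟩ : ∃ x, m' 19 0 = x := ⟨_, rfl⟩
  obtain ⟨y, hy⟩ : ∃ y, m' 20 0 = y := ⟨_, rfl⟩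
  have hat := h.attains
  have hle := h.le
  have hround := h.rounds
  rw [he, hx, hy, Nat.add_sub_cancel] at hat
  rw [he] at hle
  rw [he, hx, hy] at hround
  have hat1 := hat.step hd
  have hat2 := (hat1.symm.step hd.symm).symm
  have hx' : m' t (m' 17 0 + (m' 21 0 - 1 - y)) = G.RIS S (e - y) := by
    rw [g17, he, Nat.add_sub_cancel, hrow j _ hij (hat.left_le.trans (card_inter_le _ _)),
      hl.ris _ hat.left_le]
  have hy' : m' t (m' 18 0 + (m' 21 0 - 1 - G.RIS S (e - y))) =
      H.RIS S (e - G.RIS S (e - y)) := by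
    rw [g18, he, Nat.add_sub_cancel,
      hrow k _ hik (hat1.symm.left_le.trans (card_inter_le _ _)), hr.ris _ hat1.symm.left_le]
  have hlex := hat.le_ris
  have hley := hat1.symm.le_ris
  have hcard : ∀ {x y}, G.Attains H S e x y → x + y ≤ n := fun h =>
    (h.add_le hd).trans (by simpa using Finset.card_le_univ (G.union H).verts)
  have hsum := hcard hat2
  -- Neither component can shrink, so the tested sum vanishes exactly when the pair is saturated.
  by_cases hne : G.RIS S (e - y) - x + (H.RIS S (e - G.RIS S (e - y)) - y) = 0
  · have ex : G.RIS S (e - y) = x := by omega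
    rw [ex] at hx' hy' hley
    have ey : H.RIS S (e - x) = y := by rw [ex] at hne; omega
    rw [ey] at hy'
    have hsat : G.Saturated H S e x y := ⟨hat, ex, ey⟩
    have hris := hsat.ris_union hd
    refine ⟨s - 1, by have := hcard hat; omega, ?_⟩
    have hst : i * (n + 1) + e < (i + 1) * (n + 1) := cell_lt (Nat.lt_succ_self i) (by omega)
    have hrun := unionRisBody_run_of_eq hs hx hy hx' hy'
    rw [he, g16, Nat.add_sub_cancel] at hrun
    have hdone := h.done
    have hoff := h.off
    have htab := h.table
    generalize (unionRisBody t xs ys).run m' = m'' at hrun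
    have f21 : m'' 21 0 = e := by
      rcases hs with ⟨rfl, rfl, rfl, rfl⟩ | ⟨rfl, rfl, rfl, rfl⟩ <;> simp [hrun]
    have f19 : m'' 19 0 = x := by
      rcases hs with ⟨rfl, rfl, rfl, rfl⟩ | ⟨rfl, rfl, rfl, rfl⟩ <;> simp [hrun, hx]
    have f20 : m'' 20 0 = y := by
      rcases hs with ⟨rfl, rfl, rfl, rfl⟩ | ⟨rfl, rfl, rfl, rfl⟩ <;> simp [hrun, hy]
    have ft : m'' t = Function.update (m' t) (i * (n + 1) + e) (x + y) := by
      rcases hs with ⟨rfl, rfl, rfl, rfl⟩ | ⟨rfl, rfl, rfl, rfl⟩ <;> simp [hrun]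
    have fx : m'' xs = Function.update (m' xs) e x := by
      rcases hs with ⟨rfl, rfl, rfl, rfl⟩ | ⟨rfl, rfl, rfl, rfl⟩ <;> simp [hrun]
    have fy : m'' ys = Function.update (m' ys) e y := by
      rcases hs with ⟨rfl, rfl, rfl, rfl⟩ | ⟨rfl, rfl, rfl, rfl⟩ <;> simp [hrun]
    refine ⟨fun a ha => ?_, fun q hq => ?_, ?_, ?_, ?_, fun ℓ hℓ hℓ' => ?_⟩
    · rw [← hoff a ha, hrun]
      simp only [List.mem_cons, not_or] at ha
      simp [ha]
    · rw [ft, Function.update_of_ne (by omega), htab q hq]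
    · omega
    · rw [f21, f19, f20]; have := hcard hat; omega
    -- The pair is carried over to threshold `e - 1`; for `e = 0` truncation keeps it at `0`, and
    -- the loop ends.
    · rw [f21, f19, f20]; exact hat.mono (Nat.sub_le _ _)
    · rw [ft, fx, fy]
      rcases eq_or_ne ℓ e with rfl | hne
      · simpa only [Function.update_self] using ⟨hris.symm, hsat⟩
      · rw [Function.update_of_ne (by omega), Function.update_of_ne hne,
          Function.update_of_ne hne]
        exact hdone ℓ (by omega) hℓ'
  · obtain ⟨f19, f20, hoff⟩ := unionRisBody_run_of_ne (xs := xs) (ys := ys) hx hy hx' hy'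
      (by rcases hs with h | h <;> omega) hne
    generalize (unionRisBody t xs ys).run m' = m'' at f19 f20 hoff
    have f21 : m'' 21 0 = e + 1 := by rw [hoff 21 (by simp), he]
    have ft : m'' t = m' t := hoff t (by
      rcases hs with ⟨rfl, rfl, rfl, rfl⟩ | ⟨rfl, rfl, rfl, rfl⟩ <;> simp)
    have fx : m'' xs = m' xs := hoff xs (by
      rcases hs with ⟨rfl, rfl, rfl, rfl⟩ | ⟨rfl, rfl, rfl, rfl⟩ <;> simp)
    have fy : m'' ys = m' ys := hoff ys (by
      rcases hs with ⟨rfl, rfl, rfl, rfl⟩ | ⟨rfl, rfl, rfl, rfl⟩ <;> simp)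
    refine ⟨e + 1 + n - (m'' 19 0 + m'' 20 0), by omega, fun a ha => ?_, fun q hq => ?_, ?_,
      by omega, ?_, fun ℓ hℓ hℓ' => ?_⟩
    · rw [hoff a (fun hc => ha (by
        simp only [List.mem_cons, List.not_mem_nil, or_false] at hc ⊢; tauto)), h.off a ha]
    · rw [ft, h.table q hq]
    · rwa [f21]
    · rw [f19, f20, f21]; exact hat2
    · rw [ft, fx, fy]; exact h.done ℓ (by omega) hℓ'

theorem runs_unionRis {t c xs ys : ℕ} (hs : IsSide t c xs ys)
    (hd : Disjoint G.verts H.verts) (hG : G.IsIndep (S ∩ G.verts)) (hH : H.IsIndep (S ∩ H.verts))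
    (hij : i < j) (hik : i < k) (h15 : m 15 0 = i) (h5 : m 5 i = j) (h6 : m 6 i = k)
    (h16 : m 16 0 = i * (n + 1)) (h17 : m 17 0 = j * (n + 1)) (h18 : m 18 0 = k * (n + 1))
    (hl : RisRow t c S m j G) (hr : RisRow t c S m k H) :
    Runs (unionRis t c xs ys) m (200 * (n + 1)) (fun m' =>
      AgreesOff [t, 19, 20, 21, 22, 23, xs, ys] m m' ∧
      (∀ j, j < i * (n + 1) ∨ (i + 1) * (n + 1) ≤ j → m' t j = m t j) ∧
      ∀ ℓ ≤ (S ∩ G.verts).card + (S ∩ H.verts).card,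
        m' t (i * (n + 1) + ℓ) = (G.union H).RIS S ℓ ∧
          G.Saturated H S ℓ (m' xs ℓ) (m' ys ℓ)) := by
  have hn := card_inter_add_le hd S
  -- At most `n + 1` rounds of `97` steps, plus `3` for each test.
  refine ((LoopFree.runs (by simp [LoopFree, assign]) m).seq (t' := (n + 1) * 100 + 3)
    fun m₁ h₁ => ?_).mono ?_ fun _ h => h
  · obtain ⟨f19, f20, f21, hoff⟩ : m₁ 19 0 = (S ∩ G.verts).card ∧ m₁ 20 0 = (S ∩ H.verts).card ∧
        m₁ 21 0 = (S ∩ G.verts).card + (S ∩ H.verts).card + 1 ∧ AgreesOff [19, 20, 21] m m₁ := by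
      have hlc := hl.card
      have hrc := hr.card
      subst h₁
      refine ⟨?_, ?_, ?_, fun a ha => ?_⟩
      · rcases hs with ⟨rfl, rfl, rfl, rfl⟩ | ⟨rfl, rfl, rfl, rfl⟩ <;>
          simp [run, assign, var, eval, h15, h5, hlc]
      · rcases hs with ⟨rfl, rfl, rfl, rfl⟩ | ⟨rfl, rfl, rfl, rfl⟩ <;>
          simp [run, assign, var, eval, h15, h6, hrc]
      · rcases hs with ⟨rfl, rfl, rfl, rfl⟩ | ⟨rfl, rfl, rfl, rfl⟩ <;>
          simp [run, assign, var, eval, h15, h5, h6, hlc, hrc]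
      · simp only [List.mem_cons, not_or] at ha
        simp [run, assign, ha]
    -- The counter starts one above the sum of the pair, so the initial potential is `n + 1`
    -- whatever the size of `S`.
    have h0 : UnionRisInv n i t xs ys S G H m (n + 1) m₁ := by
      refine ⟨fun a ha => hoff a fun hc => ha ?_, fun q _ => ?_, f21.le, ?_, ?_, fun ℓ h1 h2 => ?_⟩
      · simp only [List.mem_cons, List.not_mem_nil, or_false] at hc ⊢; tauto
      · rw [hoff t (by rcases hs with ⟨rfl, rfl, rfl, rfl⟩ | ⟨rfl, rfl, rfl, rfl⟩ <;> simp)]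
      · omega
      · rw [f19, f20, f21, Nat.add_sub_cancel]
        exact attains_card hd hG hH
      · omega
    refine (Runs.loop (Inv := UnionRisInv n i t xs ys S G H m) 97 ?_ h0).mono le_rfl ?_
    · intro s m' h hpos
      obtain ⟨s', hs', h'⟩ := UnionRisInv.body hs hd hij hik h16 h17 h18 hl hr h hpos
      refine ⟨s', hs', ((LoopFree.runs (p := unionRisBody t xs ys)
        (by simp [unionRisBody, LoopFree, assign]) m').mono ?_ ?_)⟩
      · simp [unionRisBody, time, assign, var, cost]
      · rintro _ rfl; exact h'
    · rintro m' ⟨h0, s, h⟩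
      refine ⟨h.off, h.table, fun ℓ hℓ => h.done ℓ ?_ hℓ⟩
      rw [show m' 21 0 = 0 from h0]
      exact Nat.zero_le _
  · simp only [time, assign, var, cost]
    omega

end UnionNodes

section InnerNodes

variable {n : ℕ} {A B S : Finset (Fin n)} {G H : FinGraph (Fin n)} {m m' m'' : Mem} {i j k : ℕ}

/-! ### Inner nodes -/

/-- Among the arrays `0, …, 18`, only row `i` of the tables `9`, `10`, `11` differs. -/
structure RowWrite (n i : ℕ) (m m' : Mem) : Prop where
  off : ∀ a < 19, a ∉ [9, 10, 11] → m' a = m a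
  table : ∀ a ∈ [9, 10, 11], ∀ j, j < i * (n + 1) ∨ (i + 1) * (n + 1) ≤ j → m' a j = m a j

theorem RowWrite.frame (h : RowWrite n i m m') : Frame n i m m' where
  off := fun a ha ha' => h.off a (by omega) fun hc => ha' (by
    simp only [List.mem_cons, List.not_mem_nil, or_false] at hc ⊢; tauto)
  table := h.table
  count := fun a ha j _ => by
    rw [h.off a] <;> rcases List.mem_cons.1 ha with rfl | ha <;> simp_all

theorem RowWrite.trans (h : RowWrite n i m m') (h' : RowWrite n i m' m'') :
    RowWrite n i m m'' where
  off := fun a ha ha' => (h'.off a ha ha').trans (h.off a ha ha')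
  table := fun a ha j hj => (h'.table a ha j hj).trans (h.table a ha j hj)

theorem RowWrite.of_agreesOff {L : List ℕ} {t : ℕ} (ht : t ∈ [9, 10, 11])
    (hL : ∀ a ∈ L, a ∈ t :: [19, 20, 21, 22, 23, 24, 25, 26, 27, 28, 29])
    (h : AgreesOff L m m')
    (htab : ∀ j, j < i * (n + 1) ∨ (i + 1) * (n + 1) ≤ j → m' t j = m t j) :
    RowWrite n i m m' where
  off := fun a ha ha' => h a fun hc => by
    rcases List.mem_cons.1 (hL a hc) with rfl | h
    · exact ha' ht
    · simp only [List.mem_cons, List.not_mem_nil, or_false] at h; omega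
  table := fun a ha j hj => by
    rcases eq_or_ne a t with rfl | hne
    · exact htab j hj
    · rw [h a fun hc => ?_]
      rcases List.mem_cons.1 (hL a hc) with rfl | h
      · exact hne rfl
      · simp only [List.mem_cons, List.not_mem_nil, or_false] at h ha; omega

/-- The variables and counts of the inner node `i` with children `j` and `k` are set, and the rows
of the children, whose graphs are `G` and `H`, are correct. -/
structure Ready (A B : Finset (Fin n)) (i j k : ℕ) (G H : FinGraph (Fin n)) (m : Mem) :
    Prop where
  lt_left : i < j
  lt_right : i < k
  node : m 15 0 = i
  left : m 5 i = j
  right : m 6 i = k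
  row : m 16 0 = i * (n + 1)
  row_left : m 17 0 = j * (n + 1)
  row_right : m 18 0 = k * (n + 1)
  cardA : m 13 i = (A ∩ G.verts).card + (A ∩ H.verts).card
  cardB : m 14 i = (B ∩ G.verts).card + (B ∩ H.verts).card
  rowOK_left : RowOK A B m j G
  rowOK_right : RowOK A B m k H

theorem Ready.congr (h : Ready A B i j k G H m) (hw : RowWrite n i m m') :
    Ready A B i j k G H m' where
  lt_left := h.lt_left
  lt_right := h.lt_right
  node := by rw [hw.off 15 (by simp) (by simp), h.node]
  left := by rw [hw.off 5 (by simp) (by simp), h.left]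
  right := by rw [hw.off 6 (by simp) (by simp), h.right]
  row := by rw [hw.off 16 (by simp) (by simp), h.row]
  row_left := by rw [hw.off 17 (by simp) (by simp), h.row_left]
  row_right := by rw [hw.off 18 (by simp) (by simp), h.row_right]
  cardA := by rw [hw.off 13 (by simp) (by simp), h.cardA]
  cardB := by rw [hw.off 14 (by simp) (by simp), h.cardB]
  rowOK_left := h.rowOK_left.of_frame hw.frame h.lt_left.ne'
  rowOK_right := h.rowOK_right.of_frame hw.frame h.lt_right.ne'

/-- Load the rows of an inner node and its children, and add up the counts of the children. -/
def setup : Prog :=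
  seq (assign 16 (read 12 (var 15)))
  (seq (assign 17 (read 12 (read 5 (var 15))))
  (seq (assign 18 (read 12 (read 6 (var 15))))
  (seq (write 13 (var 15) (add (read 13 (read 5 (var 15))) (read 13 (read 6 (var 15)))))
  (write 14 (var 15) (add (read 14 (read 5 (var 15))) (read 14 (read 6 (var 15))))))))

theorem runs_setup (hij : i < j) (hik : i < k) (h15 : m 15 0 = i) (h5 : m 5 i = j)
    (h6 : m 6 i = k) (hi : m 12 i = i * (n + 1)) (hj : m 12 j = j * (n + 1))
    (hk : m 12 k = k * (n + 1)) (hG : RowOK A B m j G) (hH : RowOK A B m k H) :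
    Runs setup m 60 (fun m' => Frame n i m m' ∧ Ready A B i j k G H m') := by
  refine (LoopFree.runs (by simp [setup, LoopFree, assign]) m).mono
    (by simp [setup, time, assign, var, cost]) ?_
  intro m' hm'
  have hrun : m' = Function.update (Function.update (Function.update (Function.update
      (Function.update m 16 (Function.update (m 16) 0 (i * (n + 1))))
      17 (Function.update (m 17) 0 (j * (n + 1))))
      18 (Function.update (m 18) 0 (k * (n + 1))))
      13 (Function.update (m 13) i ((A ∩ G.verts).card + (A ∩ H.verts).card)))
      14 (Function.update (m 14) i ((B ∩ G.verts).card + (B ∩ H.verts).card)) := by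
    rw [hm', ← hG.risA.card, ← hH.risA.card, ← hG.risB.card, ← hH.risB.card]
    simp [setup, run, assign, var, eval, h15, h5, h6, hi, hj, hk]
  have hf : Frame n i m m' := by
    refine ⟨fun a ha ha' => ?_, fun a ha q _ => ?_, fun a ha q hq => ?_⟩
    · simp only [List.mem_cons, not_or] at ha'
      rw [hrun]
      simp [ha', show a ≠ 16 by omega, show a ≠ 17 by omega, show a ≠ 18 by omega]
    · simp only [List.mem_cons, List.not_mem_nil, or_false] at ha
      rcases ha with rfl | rfl | rfl <;> simp [hrun]
    · simp only [List.mem_cons, List.not_mem_nil, or_false] at ha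
      rcases ha with rfl | rfl <;> simp [hrun, hq]
  refine ⟨hf, hij, hik, ?_, ?_, ?_, ?_, ?_, ?_, ?_, ?_, hG.of_frame hf hij.ne',
    hH.of_frame hf hik.ne'⟩ <;> simp [hrun, h15, h5, h6]

/-! ### Reachability entries of union nodes -/

/-- Set variable `21` to one more than the minimum of the counts. -/
def initReach : Prog :=
  assign 21 (add (sub (read 13 (var 15)) (sub (read 13 (var 15)) (read 14 (var 15)))) (const 1))

/-- The minimum of `a` and `b` is `a - (a - b)`. The extra one is there because `fill` lowers its
counter before writing. -/
theorem Ready.runs_initReach (h : Ready A B i j k G H m) :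
    Runs initReach m 20 (fun m' => AgreesOff [21] m m' ∧
      m' 21 0 = min ((A ∩ G.verts).card + (A ∩ H.verts).card)
        ((B ∩ G.verts).card + (B ∩ H.verts).card) + 1) := by
  refine (LoopFree.runs (by simp [initReach, LoopFree, assign]) m).mono
    (by simp [initReach, time, assign, var, cost]) ?_
  rintro _ rfl
  refine ⟨fun a ha => ?_, ?_⟩
  · simp only [List.mem_cons, not_or] at ha
    simp [initReach, run, assign, ha]
  · simp [initReach, run, assign, var, eval, h.node, h.cardA, h.cardB]
    omega

/-- The entry of table `11` for a union node and the threshold in variable `21`. -/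
def unionReachValue : Expr :=
  sub (sub (sub (const 1)
      (sub (const 1) (read 11 (add (var 17) (sub (var 21) (read 26 (var 21)))))))
      (sub (const 1) (read 11 (add (var 18) (sub (var 21) (read 24 (var 21)))))))
    (add (add (sub (read 24 (var 21)) (read 25 (var 21))) (sub (read 25 (var 21)) (read 24 (var 21))))
      (add (sub (read 26 (var 21)) (read 27 (var 21))) (sub (read 27 (var 21)) (read 26 (var 21)))))

-- For entries `p`, `q` in `{0, 1}` the conjunction is `1 - (1 - p) - (1 - q)`. The last subtrahend
-- is the distance of the two saturated pairs, and truncation turns any positive distance into the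
-- answer `0`.
open Classical in
theorem Ready.eval_unionReachValue (h : Ready A B i j k G H m) (hd : Disjoint G.verts H.verts)
    {ℓ : ℕ} (h21 : m 21 0 = ℓ) (hA : G.Saturated H A ℓ (m 24 ℓ) (m 26 ℓ))
    (hB : G.Saturated H B ℓ (m 25 ℓ) (m 27 ℓ)) :
    unionReachValue.eval m =
      if (G.union H).TARReach ℓ (A ∩ (G.union H).verts) (B ∩ (G.union H).verts) then 1 else 0 := by
  have hiff := hA.tarReach_union_iff hd hB
  have hval : unionReachValue.eval m = 1 - (1 - m 11 (j * (n + 1) + (ℓ - m 26 ℓ))) -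
      (1 - m 11 (k * (n + 1) + (ℓ - m 24 ℓ))) - (m 24 ℓ - m 25 ℓ + (m 25 ℓ - m 24 ℓ) +
      (m 26 ℓ - m 27 ℓ + (m 27 ℓ - m 26 ℓ))) := by
    simp only [unionReachValue, var, eval, h21, h.row_left, h.row_right]
  rw [hval]
  by_cases he : m 24 ℓ = m 25 ℓ ∧ m 26 ℓ = m 27 ℓ
  -- Because the pairs agree, the thresholds are admissible for both sets, so the children's entries
  -- are meaningful.
  · rw [h.rowOK_left.reach _ (le_min hA.attains.left_le (he.2 ▸ hB.attains.left_le)),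
      h.rowOK_right.reach _ (le_min hA.attains.symm.left_le (he.1 ▸ hB.attains.symm.left_le)),
      ← he.1, ← he.2]
    simp only [hiff, he, and_self, true_and, Nat.sub_self]
    split_ifs <;> first | rfl | (exfalso; tauto)
  -- The cells read may now be irrelevant ones, but their content cannot matter.
  · rw [if_neg fun hc => he (hiff.1 hc).1]
    omega

/-- The computation of the rows of a union node. -/
def unionNode : Prog :=
  seq (unionRis 9 13 24 26) (seq (unionRis 10 14 25 27)
    (seq initReach (fill 11 21 (var 16) unionReachValue)))

theorem Ready.runs_unionNode (h : Ready A B i j k G H m) (hd : Disjoint G.verts H.verts)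
    (hAG : G.IsIndep (A ∩ G.verts)) (hAH : H.IsIndep (A ∩ H.verts))
    (hBG : G.IsIndep (B ∩ G.verts)) (hBH : H.IsIndep (B ∩ H.verts)) :
    Runs unionNode m (600 * (n + 1)) (fun m' =>
      Frame n i m m' ∧ RowOK A B m' i (G.union H)) := by
  classical
  have hcA := card_inter_add_le hd A
  have hcard : ∀ S : Finset (Fin n), (S ∩ (G.union H).verts).card =
      (S ∩ G.verts).card + (S ∩ H.verts).card := fun S => by
    rw [inter_union_verts, Finset.card_union_of_disjoint
      (hd.mono Finset.inter_subset_right Finset.inter_subset_right)]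
  have hend : i * (n + 1) + (min ((A ∩ G.verts).card + (A ∩ H.verts).card)
      ((B ∩ G.verts).card + (B ∩ H.verts).card) + 1) ≤ (i + 1) * (n + 1) := by
    have := min_le_left ((A ∩ G.verts).card + (A ∩ H.verts).card)
      ((B ∩ G.verts).card + (B ∩ H.verts).card)
    have := row_le (n := n) (Nat.lt_succ_self i)
    rw [Nat.succ_eq_add_one] at this
    omega
  refine ((runs_unionRis (Or.inl ⟨rfl, rfl, rfl, rfl⟩) hd hAG hAH h.lt_left h.lt_right h.node
    h.left h.right h.row h.row_left h.row_right h.rowOK_left.risA h.rowOK_right.risA).seq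
    fun m₁ ⟨off₁, tab₁, res₁⟩ => ?_).mono (t := 200 * (n + 1) +
      (200 * (n + 1) + (20 + ((n + 1) * 90 + 3)))) (by omega) fun _ h => h
  have w₁ : RowWrite n i m m₁ := RowWrite.of_agreesOff (by simp) (by simp) off₁ tab₁
  have r₁ := h.congr w₁
  refine (runs_unionRis (Or.inr ⟨rfl, rfl, rfl, rfl⟩) hd hBG hBH r₁.lt_left r₁.lt_right r₁.node
    r₁.left r₁.right r₁.row r₁.row_left r₁.row_right r₁.rowOK_left.risB r₁.rowOK_right.risB).seq
    fun m₂ ⟨off₂, tab₂, res₂⟩ => ?_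
  have w₂ : RowWrite n i m₁ m₂ := RowWrite.of_agreesOff (by simp) (by simp) off₂ tab₂
  have r₂ := r₁.congr w₂
  refine r₂.runs_initReach.seq fun m₃ ⟨off₃, h21⟩ => ?_
  have w₃ : RowWrite n i m₂ m₃ :=
    RowWrite.of_agreesOff (t := 11) (by simp) (by simp) off₃ fun _ _ => by rw [off₃ 11 (by simp)]
  have r₃ := r₂.congr w₃
  refine (runs_fill (r := i * (n + 1)) (f := fun ℓ =>
    if (G.union H).TARReach ℓ (A ∩ (G.union H).verts) (B ∩ (G.union H).verts) then 1 else 0)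
    (by simp) h21 ?_).mono ?_ ?_
  · intro m' ℓ hℓ hm' off' tab'
    have w' : RowWrite n i m₃ m' := RowWrite.of_agreesOff (t := 11) (by simp) (by simp) off'
      fun q hq => tab' q (by omega)
    have r' := r₃.congr w'
    refine ⟨r'.row, r'.eval_unionReachValue hd hm' ?_ ?_⟩
    -- The pairs of `A` are kept in arrays that the computation for `B` does not touch.
    · have := (res₁ ℓ (by omega)).2
      rwa [← off₂ 24 (by simp), ← off₂ 26 (by simp), ← off₃ 24 (by simp), ← off₃ 26 (by simp),
        ← off' 24 (by simp), ← off' 26 (by simp)] at this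
    · have := (res₂ ℓ (by omega)).2
      rwa [← off₃ 25 (by simp), ← off₃ 27 (by simp),
        ← off' 25 (by simp), ← off' 27 (by simp)] at this
  · simp only [unionReachValue, var, cost]
    refine Nat.add_le_add_right (Nat.mul_le_mul ?_ (by simp)) 3
    exact Nat.succ_le_succ ((min_le_left _ _).trans hcA)
  · rintro m₄ ⟨off₄, tab₄, res₄⟩
    have w₄ : RowWrite n i m₃ m₄ := RowWrite.of_agreesOff (t := 11) (by simp) (by simp) off₄
      fun q hq => tab₄ q (by omega)
    have r₄ := r₃.congr w₄
    refine ⟨(((w₁.trans w₂).trans w₃).trans w₄).frame, ⟨?_, fun ℓ hℓ => ?_⟩,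
      ⟨?_, fun ℓ hℓ => ?_⟩, fun ℓ hℓ => ?_⟩
    · rw [hcard, r₄.cardA]
    · rw [hcard] at hℓ
      rw [off₄ 9 (by simp), off₃ 9 (by simp), off₂ 9 (by simp), (res₁ ℓ hℓ).1]
    · rw [hcard, r₄.cardB]
    · rw [hcard] at hℓ
      rw [off₄ 10 (by simp), off₃ 10 (by simp), (res₂ ℓ hℓ).1]
    · rw [hcard, hcard] at hℓ
      rw [res₄ ℓ (Nat.lt_succ_of_le hℓ)]

/-! ### Join nodes -/

/-- The computation of row `i` of the table `t` for a join node `i`. Variable `s` is the row of the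
child that contains the set. -/
def joinRis (t c s : ℕ) : Prog :=
  seq (seq (ite (read c (read 5 (var 15))) (assign s (var 17)) (assign s (var 18)))
    (assign 21 (add (read c (var 15)) (const 1))))
  (seq (fill t 21 (var 16) (read t (add (var s) (var 21))))
  (write t (var 16) (add (read t (var 17)) (sub (read t (var 18)) (read t (var 17))))))

/-- At positive thresholds the row is a copy of the row of the child containing `S`. Cell `0` is
then overwritten with `a + (b - a)`, the maximum of the children's values. -/
theorem runs_joinRis {t c s : ℕ} (hs : (t = 9 ∧ c = 13 ∧ s = 28) ∨ (t = 10 ∧ c = 14 ∧ s = 29))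
    (hd : Disjoint G.verts H.verts) (hS : (G.join H).IsIndep (S ∩ (G.join H).verts))
    (hij : i < j) (hik : i < k) (h15 : m 15 0 = i) (h5 : m 5 i = j)
    (h16 : m 16 0 = i * (n + 1)) (h17 : m 17 0 = j * (n + 1)) (h18 : m 18 0 = k * (n + 1))
    (hc : m c i = (S ∩ G.verts).card + (S ∩ H.verts).card)
    (hl : RisRow t c S m j G) (hr : RisRow t c S m k H) :
    Runs (joinRis t c s) m (100 * (n + 1)) (fun m' =>
      AgreesOff [t, 21, s] m m' ∧
      (∀ j, j < i * (n + 1) ∨ (i + 1) * (n + 1) ≤ j → m' t j = m t j) ∧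
      m' s 0 = (if (S ∩ G.verts).card = 0 then k * (n + 1) else j * (n + 1)) ∧
      ∀ ℓ ≤ (S ∩ G.verts).card + (S ∩ H.verts).card,
        m' t (i * (n + 1) + ℓ) = (G.join H).RIS S ℓ) := by
  have hn := card_inter_add_le hd S
  have hend : i * (n + 1) + ((S ∩ G.verts).card + (S ∩ H.verts).card + 1) ≤
      (i + 1) * (n + 1) := by
    have := row_le (n := n) (Nat.lt_succ_self i)
    rw [Nat.succ_eq_add_one] at this
    omega
  have hrj := row_le (n := n) hij
  have hrk := row_le (n := n) hik
  -- If `S` misses both sides, the choice is immaterial: only threshold `0` is relevant, and its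
  -- cell is overwritten.
  set src := if (S ∩ G.verts).card = 0 then k * (n + 1) else j * (n + 1) with hsrc
  have hsrcle : i * (n + 1) + (n + 1) ≤ src := by rw [hsrc]; split_ifs <;> assumption
  refine ((LoopFree.runs (by simp [LoopFree, assign]) m).seq (t' := (n + 1) * 40 + 3 + 15)
    fun m₁ h₁ => ?_).mono ?_ fun _ h => h
  · obtain ⟨f21, fs, hoff⟩ : m₁ 21 0 = (S ∩ G.verts).card + (S ∩ H.verts).card + 1 ∧
        m₁ s 0 = src ∧ AgreesOff [21, s] m m₁ := by
      have hlc := hl.card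
      subst h₁
      refine ⟨?_, ?_, fun a ha => ?_⟩
      · rcases hs with ⟨rfl, rfl, rfl⟩ | ⟨rfl, rfl, rfl⟩ <;>
          by_cases h0 : (S ∩ G.verts).card = 0 <;>
          simp [run, assign, var, eval, h15, h5, hc, hlc, h0]
      · rcases hs with ⟨rfl, rfl, rfl⟩ | ⟨rfl, rfl, rfl⟩ <;>
          by_cases h0 : (S ∩ G.verts).card = 0 <;>
          simp only [run, assign, var, eval, h15, h5, hlc, h0, h17, h18, hsrc] <;> simp
      · simp only [List.mem_cons, not_or] at ha
        simp only [run, assign]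
        split_ifs <;> simp [ha]
    have g16 : m₁ 16 0 = i * (n + 1) := by
      rw [← h16, hoff 16 (by rcases hs with ⟨rfl, rfl, rfl⟩ | ⟨rfl, rfl, rfl⟩ <;> simp)]
    have gt : m₁ t = m t := hoff t (by rcases hs with ⟨rfl, rfl, rfl⟩ | ⟨rfl, rfl, rfl⟩ <;> simp)
    have hts : t ≠ 21 ∧ s ≠ t ∧ s ≠ 21 ∧ t ≠ 16 ∧ t ≠ 17 ∧ t ≠ 18 ∧ s ≠ 17 ∧ s ≠ 18 := by
      rcases hs with ⟨rfl, rfl, rfl⟩ | ⟨rfl, rfl, rfl⟩ <;> simp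
    refine (runs_fill (r := i * (n + 1)) (f := fun ℓ => m t (src + ℓ)) hts.1 f21 ?_).seq
      (t := _) (t' := 15) (R := _) ?_ |>.mono ?_ fun _ h => h
    · intro m' ℓ hℓ hm' off' tab'
      refine ⟨?_, ?_⟩
      · simp only [var, eval]
        rw [off' 16 (by simp [hts.2.2.2.1.symm]), g16]
      · simp only [var, eval, hm']
        -- Source and target are in one table, but the source row starts beyond row `i`.
        rw [off' s (by simp [hts]), fs, tab' _ (by omega), gt]
    · rintro m₂ ⟨off₂, tab₂, res₂⟩
      have k16 : m₂ 16 0 = i * (n + 1) := by rw [off₂ 16 (by simp [hts.2.2.2.1.symm]), g16]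
      have k17 : m₂ 17 0 = j * (n + 1) := by
        rw [off₂ 17 (by simp [hts.2.2.2.2.1.symm]), hoff 17 (by simp [hts.2.2.2.2.2.2.1.symm]), h17]
      have k18 : m₂ 18 0 = k * (n + 1) := by
        rw [off₂ 18 (by simp [hts.2.2.2.2.2.1.symm]), hoff 18 (by simp [hts.2.2.2.2.2.2.2.symm]),
          h18]
      refine (LoopFree.runs (by simp [LoopFree]) m₂).mono (by simp [time, var, cost]) ?_
      intro m₃ h₃
      have hrl := hl.ris 0 (Nat.zero_le _)
      have hrr := hr.ris 0 (Nat.zero_le _)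
      rw [Nat.add_zero] at hrl hrr
      have hrun : m₃ = Function.update m₂ t (Function.update (m₂ t) (i * (n + 1))
          ((G.join H).RIS S 0)) := by
        rw [h₃, ris_join_zero hd hS]
        simp only [run, var, eval, k16, k17, k18]
        rw [tab₂ _ (by omega), tab₂ _ (by omega), gt, hrl, hrr]
        congr 2
        omega
      refine ⟨fun a ha => ?_, fun q hq => ?_, ?_, fun ℓ hℓ => ?_⟩
      · simp only [List.mem_cons, not_or] at ha
        rw [hrun, Function.update_of_ne ha.1, off₂ a (by simp [ha]), hoff a (by simp [ha])]
      · rw [hrun, Function.update_self, Function.update_of_ne (by omega), tab₂ q (by omega), gt]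
      · rw [hrun, Function.update_of_ne hts.2.1, off₂ s (by simp [hts]), fs]
      · rw [hrun, Function.update_self]
        rcases Nat.eq_zero_or_pos ℓ with rfl | hpos
        · simp only [Nat.add_zero, Function.update_self]
        rw [Function.update_of_ne (by omega), res₂ ℓ (by omega), hsrc]
        split_ifs with h0
        · rw [Finset.card_eq_zero] at h0
          rw [join_comm, ris_join_of_pos hd.symm hpos h0, hr.ris ℓ (by simpa [h0] using hℓ)]
        · have h0' := inter_right_eq_empty_of_join hd hS (Finset.card_pos.1 (Nat.pos_of_ne_zero h0))
          rw [ris_join_of_pos hd hpos h0', hl.ris ℓ (by simpa [h0'] using hℓ)]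
    · refine Nat.add_le_add_right (Nat.add_le_add_right (Nat.mul_le_mul (by omega) ?_) 3) _
      simp [var, cost]
  · simp only [time, assign, var, cost]
    omega

/-- The entry of table `11` for a join node and the threshold in variable `21`, if that is
positive. -/
def joinReachValue : Expr :=
  sub (sub (const 1) (sub (const 1) (read 11 (add (var 28) (var 21)))))
    (add (sub (var 28) (var 29)) (sub (var 29) (var 28)))

/-- The computation of the rows of a join node. -/
def joinNode : Prog :=
  seq (joinRis 9 13 28) (seq (joinRis 10 14 29)
    (seq initReach (seq (fill 11 21 (var 16) joinReachValue) (write 11 (var 16) (const 1)))))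

-- The row addresses `a` and `b` serve as labels of the sides. Equal labels refer the question to
-- one child; different labels mean sets on opposite sides, which a positive threshold keeps apart.
open Classical in
theorem Ready.joinReachValue_eq (h : Ready A B i j k G H m) (hd : Disjoint G.verts H.verts)
    (hA : (G.join H).IsIndep (A ∩ (G.join H).verts))
    (hB : (G.join H).IsIndep (B ∩ (G.join H).verts)) {a b ℓ : ℕ}
    (ha : a = if (A ∩ G.verts).card = 0 then k * (n + 1) else j * (n + 1))
    (hb : b = if (B ∩ G.verts).card = 0 then k * (n + 1) else j * (n + 1)) (hjk : j ≠ k)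
    (hℓ : 1 ≤ ℓ) (hℓA : ℓ ≤ (A ∩ G.verts).card + (A ∩ H.verts).card)
    (hℓB : ℓ ≤ (B ∩ G.verts).card + (B ∩ H.verts).card) :
    1 - (1 - m 11 (a + ℓ)) - (a - b + (b - a)) =
      if (G.join H).TARReach ℓ (A ∩ (G.join H).verts) (B ∩ (G.join H).verts) then 1 else 0 := by
  have hne : j * (n + 1) ≠ k * (n + 1) := fun hc => hjk (Nat.eq_of_mul_eq_mul_right (by omega) hc)
  have side : ∀ {S : Finset (Fin n)}, (G.join H).IsIndep (S ∩ (G.join H).verts) →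
      (S ∩ G.verts).card ≠ 0 → S ∩ H.verts = ∅ := fun hS h0 =>
    inter_right_eq_empty_of_join hd hS (Finset.card_pos.1 (Nat.pos_of_ne_zero h0))
  -- A reconfiguration would stay in `H`, so a nonempty subset of `G` would lie in `H`.
  have sep : ∀ {S S' : Finset (Fin n)}, S ∩ G.verts = ∅ → S' ∩ H.verts = ∅ →
      ℓ ≤ (S ∩ G.verts).card + (S ∩ H.verts).card →
      ¬ (G.join H).TARReach ℓ (S ∩ (G.join H).verts) (S' ∩ (G.join H).verts) := by
    intro S S' h1 h2 hc hr
    rw [inter_join_verts_of_empty h2, join_comm, inter_join_verts_of_empty h1,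
      tarReach_join_iff hd.symm hℓ Finset.inter_subset_right] at hr
    have hsub := hr.indep_right.1
    obtain ⟨v, hv⟩ := Finset.card_pos.1 (hℓ.trans hr.card_right)
    exact Finset.disjoint_left.1 hd (Finset.mem_inter.1 hv).2 (hsub hv)
  by_cases hA0 : (A ∩ G.verts).card = 0 <;> by_cases hB0 : (B ∩ G.verts).card = 0
  · rw [if_pos hA0] at ha
    rw [if_pos hB0] at hb
    rw [Finset.card_eq_zero] at hA0 hB0
    rw [hA0, Finset.card_empty, Nat.zero_add] at hℓA
    rw [hB0, Finset.card_empty, Nat.zero_add] at hℓB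
    rw [join_comm, inter_join_verts_of_empty hA0, inter_join_verts_of_empty hB0,
      tarReach_join_iff hd.symm hℓ Finset.inter_subset_right, ha, hb,
      h.rowOK_right.reach ℓ (le_min hℓA hℓB)]
    split_ifs <;> simp
  · rw [if_pos hA0] at ha
    rw [if_neg hB0] at hb
    rw [Finset.card_eq_zero] at hA0
    rw [if_neg (sep hA0 (side hB hB0) hℓA)]
    omega
  · rw [if_neg hA0] at ha
    rw [if_pos hB0] at hb
    rw [Finset.card_eq_zero] at hB0
    rw [if_neg fun hc => sep hB0 (side hA hA0) hℓB hc.symm]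
    omega
  · rw [if_neg hA0] at ha
    rw [if_neg hB0] at hb
    have hA1 := side hA hA0
    have hB1 := side hB hB0
    rw [hA1, Finset.card_empty, Nat.add_zero] at hℓA
    rw [hB1, Finset.card_empty, Nat.add_zero] at hℓB
    rw [inter_join_verts_of_empty hA1, inter_join_verts_of_empty hB1,
      tarReach_join_iff hd hℓ Finset.inter_subset_right, ha, hb,
      h.rowOK_left.reach ℓ (le_min hℓA hℓB)]
    split_ifs <;> simp

theorem Ready.runs_joinNode (h : Ready A B i j k G H m) (hd : Disjoint G.verts H.verts)
    (hjk : j ≠ k) (hA : (G.join H).IsIndep (A ∩ (G.join H).verts))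
    (hB : (G.join H).IsIndep (B ∩ (G.join H).verts)) :
    Runs joinNode m (600 * (n + 1)) (fun m' =>
      Frame n i m m' ∧ RowOK A B m' i (G.join H)) := by
  classical
  have hcA := card_inter_add_le hd A
  have hcard : ∀ S : Finset (Fin n), (S ∩ (G.join H).verts).card =
      (S ∩ G.verts).card + (S ∩ H.verts).card := fun S => by
    rw [inter_join_verts, Finset.card_union_of_disjoint
      (hd.mono Finset.inter_subset_right Finset.inter_subset_right)]
  have hend : i * (n + 1) + (min ((A ∩ G.verts).card + (A ∩ H.verts).card)
      ((B ∩ G.verts).card + (B ∩ H.verts).card) + 1) ≤ (i + 1) * (n + 1) := by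
    have := min_le_left ((A ∩ G.verts).card + (A ∩ H.verts).card)
      ((B ∩ G.verts).card + (B ∩ H.verts).card)
    have := row_le (n := n) (Nat.lt_succ_self i)
    rw [Nat.succ_eq_add_one] at this
    omega
  have hrj := row_le (n := n) h.lt_left
  have hrk := row_le (n := n) h.lt_right
  refine ((runs_joinRis (Or.inl ⟨rfl, rfl, rfl⟩) hd hA h.lt_left h.lt_right h.node
    h.left h.row h.row_left h.row_right h.cardA h.rowOK_left.risA h.rowOK_right.risA).seq
    fun m₁ ⟨off₁, tab₁, src₁, res₁⟩ => ?_).mono (t := 100 * (n + 1) +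
      (100 * (n + 1) + (20 + (((n + 1) * 60 + 3) + 10)))) (by omega) fun _ h => h
  have w₁ : RowWrite n i m m₁ := RowWrite.of_agreesOff (by simp) (by simp) off₁ tab₁
  have r₁ := h.congr w₁
  refine (runs_joinRis (Or.inr ⟨rfl, rfl, rfl⟩) hd hB r₁.lt_left r₁.lt_right r₁.node
    r₁.left r₁.row r₁.row_left r₁.row_right r₁.cardB r₁.rowOK_left.risB r₁.rowOK_right.risB).seq
    fun m₂ ⟨off₂, tab₂, src₂, res₂⟩ => ?_
  have w₂ : RowWrite n i m₁ m₂ := RowWrite.of_agreesOff (by simp) (by simp) off₂ tab₂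
  have r₂ := r₁.congr w₂
  refine r₂.runs_initReach.seq fun m₃ ⟨off₃, h21⟩ => ?_
  have w₃ : RowWrite n i m₂ m₃ :=
    RowWrite.of_agreesOff (t := 11) (by simp) (by simp) off₃ fun _ _ => by rw [off₃ 11 (by simp)]
  have r₃ := r₂.congr w₃
  rw [← off₂ 28 (by simp), ← off₃ 28 (by simp)] at src₁
  rw [← off₃ 29 (by simp)] at src₂
  have hsrcle : i * (n + 1) + (n + 1) ≤ m₃ 28 0 := by rw [src₁]; split_ifs <;> assumption
  -- The raw value is used here, since it need not be correct at threshold `0`, where the cell is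
  -- later set to `1`.
  refine ((runs_fill (r := i * (n + 1)) (f := fun ℓ =>
    1 - (1 - m₃ 11 (m₃ 28 0 + ℓ)) - (m₃ 28 0 - m₃ 29 0 + (m₃ 29 0 - m₃ 28 0)))
    (by simp) h21 ?_).mono (t' := (n + 1) * 60 + 3) ?_ fun _ h => h).seq ?_
  · intro m' ℓ hℓ hm' off' tab'
    simp only [joinReachValue, var, eval, hm']
    rw [off' 16 (by simp), r₃.row, off' 28 (by simp),
      off' 29 (by simp), tab' _ (by omega)]
    exact ⟨rfl, rfl⟩
  · simp only [joinReachValue, var, cost]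
    refine Nat.add_le_add_right (Nat.mul_le_mul ?_ (by simp)) 3
    exact Nat.succ_le_succ ((min_le_left _ _).trans hcA)
  · rintro m₄ ⟨off₄, tab₄, res₄⟩
    have w₄ : RowWrite n i m₃ m₄ := RowWrite.of_agreesOff (t := 11) (by simp) (by simp) off₄
      fun q hq => tab₄ q (by omega)
    have r₄ := r₃.congr w₄
    refine (LoopFree.runs (by simp [LoopFree]) m₄).mono (by simp [time, var, cost]) ?_
    intro m₅ h₅
    have hrun : m₅ = Function.update m₄ 11 (Function.update (m₄ 11) (i * (n + 1)) 1) := by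
      rw [h₅]; simp only [run, var, eval, r₄.row]
    have off₅ : AgreesOff [11] m₄ m₅ := fun a ha => by
      rw [hrun, Function.update_of_ne (by simpa using ha)]
    have w₅ : RowWrite n i m₄ m₅ := RowWrite.of_agreesOff (t := 11) (by simp) (by simp) off₅
      fun q hq => by rw [hrun, Function.update_self, Function.update_of_ne (by omega)]
    have r₅ := r₄.congr w₅
    refine ⟨((((w₁.trans w₂).trans w₃).trans w₄).trans w₅).frame, ⟨?_, fun ℓ hℓ => ?_⟩,
      ⟨?_, fun ℓ hℓ => ?_⟩, fun ℓ hℓ => ?_⟩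
    · rw [hcard, r₅.cardA]
    · rw [hcard] at hℓ
      rw [off₅ 9 (by simp), off₄ 9 (by simp), off₃ 9 (by simp), off₂ 9 (by simp), res₁ ℓ hℓ]
    · rw [hcard, r₅.cardB]
    · rw [hcard] at hℓ
      rw [off₅ 10 (by simp), off₄ 10 (by simp), off₃ 10 (by simp), res₂ ℓ hℓ]
    · rw [hcard, hcard] at hℓ
      rw [hrun, Function.update_self]
      rcases Nat.eq_zero_or_pos ℓ with rfl | hpos
      · simp only [Nat.add_zero, Function.update_self, if_pos (tarReach_zero hA hB)]
      · rw [Function.update_of_ne (by omega), res₄ ℓ (Nat.lt_succ_of_le hℓ)]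
        exact r₃.joinReachValue_eq hd hA hB src₁ src₂ hjk hpos (hℓ.trans (min_le_left _ _))
          (hℓ.trans (min_le_right _ _))

end InnerNodes

section Algorithm

variable {n : ℕ} {A B S : Finset (Fin n)} {H : FinGraph (Fin n)} {m m' : Mem} {i j k : ℕ}

/-! ### Trivial leaves -/

/-- The rows of a trivial leaf. -/
def leafNode : Prog :=
  seq (assign 16 (read 12 (var 15)))
  (seq (write 9 (var 16) (const 1)) (seq (write 9 (add (var 16) (const 1)) (const 1))
  (seq (write 10 (var 16) (const 1)) (seq (write 10 (add (var 16) (const 1)) (const 1))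
  (seq (write 11 (var 16) (const 1)) (write 11 (add (var 16) (const 1)) (const 1)))))))

/-- With one vertex, all relevant entries are `1`. Two cells are written, and `0 < n` makes the row
wide enough. -/
theorem runs_leafNode (hn : 0 < n) (hH : H.verts.card = 1) (h15 : m 15 0 = i)
    (h12 : m 12 i = i * (n + 1)) (hA : m 13 i = (A ∩ H.verts).card)
    (hB : m 14 i = (B ∩ H.verts).card) :
    Runs leafNode m 60 (fun m' => Frame n i m m' ∧ RowOK A B m' i H) := by
  refine (LoopFree.runs (by simp [leafNode, LoopFree, assign]) m).mono
    (by simp [leafNode, time, assign, var, cost]) ?_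
  intro m' hm'
  have hend := row_le (n := n) (Nat.lt_succ_self i)
  rw [Nat.succ_eq_add_one] at hend
  have hoff : AgreesOff [9, 10, 11, 16] m m' := fun a ha => by
    simp only [List.mem_cons, not_or] at ha
    simp [hm', leafNode, run, assign, ha]
  have htab : ∀ a ∈ [9, 10, 11], m' a = Function.update (Function.update (m a) (i * (n + 1)) 1)
      (i * (n + 1) + 1) 1 := fun a ha => by
    simp only [List.mem_cons, List.not_mem_nil, or_false] at ha
    rcases ha with rfl | rfl | rfl <;> simp [hm', leafNode, run, assign, var, eval, h15, h12]
  have hval : ∀ a ∈ [9, 10, 11], ∀ ℓ ≤ 1, m' a (i * (n + 1) + ℓ) = 1 := fun a ha ℓ hℓ => by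
    rw [htab a ha]
    interval_cases ℓ <;> simp
  have hle : ∀ S : Finset (Fin n), (S ∩ H.verts).card ≤ 1 := fun S =>
    hH ▸ Finset.card_le_card Finset.inter_subset_right
  refine ⟨⟨fun a ha ha' => hoff a ?_, fun a ha q hq => ?_, fun a ha q _ => ?_⟩,
    ⟨?_, fun ℓ hℓ => ?_⟩, ⟨?_, fun ℓ hℓ => ?_⟩, fun ℓ hℓ => ?_⟩
  · simp only [List.mem_cons, List.not_mem_nil, or_false] at ha' ⊢; omega
  · rw [htab a ha, Function.update_of_ne (by omega), Function.update_of_ne (by omega)]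
  · rw [hoff a]
    simp only [List.mem_cons, List.not_mem_nil, or_false] at ha ⊢; omega
  · rw [hoff 13 (by simp), hA]
  · rw [hval 9 (by simp) ℓ (hℓ.trans (hle A)), ris_of_card_eq_one hH hℓ]
  · rw [hoff 14 (by simp), hB]
  · rw [hval 10 (by simp) ℓ (hℓ.trans (hle B)), ris_of_card_eq_one hH hℓ]
  · rw [hval 11 (by simp) ℓ ((hℓ.trans (min_le_left _ _)).trans (hle A)),
      if_pos (tarReach_of_card_eq_one hH (hℓ.trans (min_le_left _ _))
        (hℓ.trans (min_le_right _ _)))]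

/-! ### Preparations -/

/-- Write the first cell of each row to array `12`. -/
def initRows : Prog :=
  Prog.loop (sub (read 0 (const 2)) (var 16))
    (seq (write 12 (var 16) (var 17))
    (seq (assign 16 (add (var 16) (const 1)))
    (assign 17 (add (var 17) (add (read 0 (const 0)) (const 1))))))

/-- The machine cannot multiply, so the multiples of `n + 1` are accumulated by addition. -/
theorem runs_initRows {N : ℕ} (hn : m 0 0 = n) (hN : m 0 2 = N) (h16 : m 16 0 = 0)
    (h17 : m 17 0 = 0) :
    Runs initRows m (N * 30 + 10) (fun m' => AgreesOff [12, 16, 17] m m' ∧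
      ∀ j < N, m' 12 j = j * (n + 1)) := by
  refine (Runs.loop (Inv := fun s m' => m' 16 0 + s = N ∧ m' 17 0 = m' 16 0 * (n + 1) ∧
    AgreesOff [12, 16, 17] m m' ∧ ∀ j < m' 16 0, m' 12 j = j * (n + 1)) 23 ?_
    (s := N) ⟨by omega, by simp [h16, h17], fun _ _ => rfl, by simp [h16]⟩).mono
    (by simp only [var, cost]; omega) ?_
  · rintro s m₁ ⟨h1, h2, h3, h4⟩ hb
    simp only [var, eval] at hb
    have g0 : m₁ 0 = m 0 := h3 0 (by simp)
    rw [g0, hN] at hb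
    refine ⟨s - 1, by omega, (LoopFree.runs (by simp [LoopFree, assign]) m₁).mono
      (by simp [time, assign, var, cost]) ?_⟩
    rintro m₂ hm₂
    have hrun : m₂ = Function.update (Function.update (Function.update m₁
        12 (Function.update (m₁ 12) (m₁ 16 0) (m₁ 17 0)))
        16 (Function.update (m₁ 16) 0 (m₁ 16 0 + 1)))
        17 (Function.update (m₁ 17) 0 (m₁ 17 0 + (n + 1))) := by
      simp [hm₂, run, assign, var, eval, g0, hn]
    have e16 : m₂ 16 0 = m₁ 16 0 + 1 := by simp [hrun]
    have e12 : m₂ 12 = Function.update (m₁ 12) (m₁ 16 0) (m₁ 17 0) := by simp [hrun]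
    refine ⟨by omega, ?_, fun a ha => ?_, fun q hq => ?_⟩
    · rw [e16, Nat.succ_mul, ← h2]; simp [hrun]
    · rw [← h3 a ha, hrun]
      simp only [List.mem_cons, not_or] at ha
      simp [ha]
    · rw [e12, Function.update_apply]
      split_ifs with hc
      · rw [h2, hc]
      · exact h4 q (by omega)
  · rintro m₁ ⟨hb, s, h1, h2, h3, h4⟩
    simp only [var, eval] at hb
    rw [h3 0 (by simp), hN] at hb
    exact ⟨h3, fun q hq => h4 q (by omega)⟩

/-- For every leaf, count the elements of the two sets in arrays `13` and `14`. -/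
def initCounts : Prog :=
  Prog.loop (sub (read 0 (const 0)) (var 18))
    (seq (write 13 (read 8 (var 18)) (add (read 13 (read 8 (var 18))) (read 2 (var 18))))
    (seq (write 14 (read 8 (var 18)) (add (read 14 (read 8 (var 18))) (read 3 (var 18))))
    (assign 18 (add (var 18) (const 1)))))

/-- The number of elements of `S` below `c` that are mapped to `i`. -/
def countBelow (S : Finset (Fin n)) (f : ℕ → ℕ) (c i : ℕ) : ℕ :=
  (S.filter fun v : Fin n => (v : ℕ) < c ∧ f v = i).card

theorem countBelow_succ (S : Finset (Fin n)) (f : ℕ → ℕ) (c : Fin n) :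
    countBelow S f (c + 1) = Function.update (countBelow S f c) (f c)
      (countBelow S f c (f c) + if c ∈ S then 1 else 0) := by
  funext i
  have hlt : ∀ v : Fin n, (v : ℕ) < c + 1 ↔ (v : ℕ) < c ∨ v = c := fun v => by
    rw [Fin.ext_iff]; omega
  rw [Function.update_apply]
  by_cases h : c ∈ S ∧ f c = i
  · obtain ⟨hc, rfl⟩ := h
    have : (S.filter fun v : Fin n => (v : ℕ) < c + 1 ∧ f v = f c) =
        insert c (S.filter fun v : Fin n => (v : ℕ) < c ∧ f v = f c) := by
      ext v
      simp only [Finset.mem_filter, Finset.mem_insert, hlt]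
      constructor
      · tauto
      · rintro (rfl | h)
        · exact ⟨hc, Or.inr rfl, rfl⟩
        · tauto
    rw [if_pos rfl, if_pos hc, countBelow, this, Finset.card_insert_of_notMem (by simp)]
    rfl
  · have : (S.filter fun v : Fin n => (v : ℕ) < c + 1 ∧ f v = i) =
        S.filter fun v : Fin n => (v : ℕ) < c ∧ f v = i := by
      ext v
      simp only [Finset.mem_filter, hlt]
      constructor
      · rintro ⟨hv, hv' | rfl, hf⟩
        · exact ⟨hv, hv', hf⟩
        · exact absurd ⟨hv, hf⟩ h
      · tauto
    rw [countBelow, this]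
    split_ifs with h1 h2
    · exact absurd ⟨h2, h1.symm⟩ h
    · rw [h1]; rfl
    · rfl

theorem runs_initCounts (hn : m 0 0 = n) (hA : ∀ v : Fin n, m 2 v = if v ∈ A then 1 else 0)
    (hB : ∀ v : Fin n, m 3 v = if v ∈ B then 1 else 0) (h13 : ∀ i, m 13 i = 0)
    (h14 : ∀ i, m 14 i = 0) (h18 : m 18 0 = 0) :
    Runs initCounts m (n * 50 + 10) (fun m' => AgreesOff [13, 14, 18] m m' ∧
      m' 13 = countBelow A (m 8) n ∧ m' 14 = countBelow B (m 8) n) := by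
  refine (Runs.loop (Inv := fun s m' => m' 18 0 + s = n ∧ AgreesOff [13, 14, 18] m m' ∧
    m' 13 = countBelow A (m 8) (m' 18 0) ∧ m' 14 = countBelow B (m 8) (m' 18 0)) 43 ?_
    (s := n) ⟨by omega, fun _ _ => rfl, ?_, ?_⟩).mono (by simp only [var, cost]; omega) ?_
  · rintro s m₁ ⟨h1, h2, h3, h4⟩ hb
    simp only [var, eval] at hb
    rw [h2 0 (by simp), hn] at hb
    have hlt : m₁ 18 0 < n := by omega
    refine ⟨s - 1, by omega, (LoopFree.runs (by simp [LoopFree, assign]) m₁).mono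
      (by simp [time, assign, var, cost]) ?_⟩
    rintro m₂ hm₂
    have hrun : m₂ = Function.update (Function.update (Function.update m₁
        13 (countBelow A (m 8) (m₁ 18 0 + 1))) 14 (countBelow B (m 8) (m₁ 18 0 + 1)))
        18 (Function.update (m₁ 18) 0 (m₁ 18 0 + 1)) := by
      have eA := countBelow_succ A (m 8) ⟨m₁ 18 0, hlt⟩
      have eB := countBelow_succ B (m 8) ⟨m₁ 18 0, hlt⟩
      have vA := hA ⟨m₁ 18 0, hlt⟩
      have vB := hB ⟨m₁ 18 0, hlt⟩
      simp only at eA eB vA vB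
      rw [eA, eB, ← vA, ← vB, ← h3, ← h4]
      have g2 := h2 2 (by simp)
      have g3 := h2 3 (by simp)
      have g8 := h2 8 (by simp)
      simp [hm₂, run, assign, var, eval, g2, g3, g8]
    have e18 : m₂ 18 0 = m₁ 18 0 + 1 := by simp [hrun]
    refine ⟨by omega, fun a ha => ?_, ?_, ?_⟩
    · rw [← h2 a ha, hrun]
      simp only [List.mem_cons, not_or] at ha
      simp [ha]
    · rw [e18]; simp [hrun]
    · rw [e18]; simp [hrun]
  · funext i; simp [h13, h18, countBelow]
  · funext i; simp [h14, h18, countBelow]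
  · rintro m₁ ⟨hb, s, h1, h2, h3, h4⟩
    simp only [var, eval] at hb
    rw [h2 0 (by simp), hn] at hb
    have e : m₁ 18 0 = n := by omega
    rw [e] at h3 h4
    exact ⟨h2, h3, h4⟩

variable {G : SimpleGraph (Fin n)} {T : Cotree (Fin n)}

/-- Every vertex lies in some leaf, whose number the map returns; the value `i` therefore identifies
the leaf of `H`. -/
theorem countBelow_eq_card (hT : T.graph.verts = Finset.univ)
    {f : ℕ → ℕ} (hf : ∀ (j : ℕ) (H : FinGraph (Fin n)), T.nodes[j]? = some (Cotree.leaf H) →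
      ∀ v ∈ H.verts, f v = j) (hi : T.nodes[i]? = some (Cotree.leaf H)) (S : Finset (Fin n)) :
    countBelow S f n i = (S ∩ H.verts).card := by
  rw [countBelow]
  congr 1
  ext v
  simp only [Finset.mem_filter, Finset.mem_inter, Fin.is_lt, true_and]
  refine and_congr_right fun _ => ⟨fun hv => ?_, hf i H hi v⟩
  obtain ⟨H', hH', hv'⟩ := Cotree.exists_leaf_of_mem_verts (hT ▸ Finset.mem_univ v)
  obtain ⟨j, hj⟩ := List.mem_iff_getElem?.1 hH'
  have := hf j H' hj v hv'
  rw [← this, hv, hi] at hj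
  cases hj
  exact hv'

/-! ### The main loop -/

/-- The computation of the rows of the node in variable `15`. -/
def nodeRows : Prog :=
  ite (read 4 (var 15))
    (seq setup (ite (sub (read 4 (var 15)) (const 1)) joinNode unionNode))
    (ite (add (sub (read 7 (var 15)) (const 1)) (sub (const 1) (read 7 (var 15))))
      Prog.skip leafNode)

/-- The assertions of the main loop when the nodes `s, s + 1, …` have been processed; `m` is the
input. -/
structure MainInv (T : Cotree (Fin n)) (A B : Finset (Fin n)) (m : Mem) (s : ℕ) (m' : Mem) :
    Prop where
  input : ∀ a < 9, m' a = m a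
  rows : ∀ j < T.nodes.length, m' 12 j = j * (n + 1)
  done : ∀ j S, s ≤ j → T.nodes[j]? = some S → RowOK A B m' j S.graph
  leaf : ∀ j H, T.nodes[j]? = some (Cotree.leaf H) →
    m' 13 j = (A ∩ H.verts).card ∧ m' 14 j = (B ∩ H.verts).card ∧
      (H.verts.card ≠ 1 → RowOK A B m' j H)

theorem MainInv.runs_nodeRows (hn : 0 < n) (hT : T.WellFormed)
    (hA : T.graph.toSimpleGraph.IsIndepSet (A : Set (Fin n)))
    (hB : T.graph.toSimpleGraph.IsIndepSet (B : Set (Fin n)))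
    (hin : IsInput G T k A B m) (h : MainInv T A B m (i + 1) m') (h15 : m' 15 0 = i)
    {S : Cotree (Fin n)} (hS : T.nodes[i]? = some S) :
    Runs nodeRows m' (700 * (n + 1)) (fun m'' => Frame n i m' m'' ∧ RowOK A B m'' i S.graph) := by
  have g4 : m' 4 = m 4 := h.input 4 (by simp)
  have g5 : m' 5 = m 5 := h.input 5 (by simp)
  have g6 : m' 6 = m 6 := h.input 6 (by simp)
  have g7 : m' 7 = m 7 := h.input 7 (by simp)
  have lt_of : ∀ {j} {S : Cotree (Fin n)}, T.nodes[j]? = some S → j < T.nodes.length :=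
    fun h => (List.getElem?_eq_some_iff.1 h).1
  have hwf := hT.of_mem (List.mem_of_getElem? hS)
  cases S with
  | leaf H =>
    obtain ⟨i4, i7, -⟩ := hin.leaf i H hS
    obtain ⟨cA, cB, hrow⟩ := h.leaf i H hS
    refine (Runs.ite_neg (t := 80) (by simp [var, eval, h15, g4, i4]) ?_).mono
      (by simp only [var, cost]; omega) fun _ h => h
    by_cases h1 : H.verts.card = 1
    · refine (Runs.ite_neg (by simp [var, eval, h15, g7, i7, h1])
        (runs_leafNode hn h1 h15 (h.rows i (lt_of hS)) cA cB)).mono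
        (by simp only [var, cost]; omega) fun _ h => h
    · refine (Runs.ite_pos (t := 1) ?_ ((LoopFree.runs (p := Prog.skip) trivial m').mono le_rfl
        ?_)).mono (by simp only [var, cost]; omega) fun _ h => h
      -- The sum of the two truncated differences is nonzero exactly when the order of the leaf is
      -- not `1`.
      · simp only [var, eval, h15, g7, i7]; omega
      · rintro _ rfl
        exact ⟨⟨fun _ _ _ => rfl, fun _ _ _ _ => rfl, fun _ _ _ _ => rfl⟩, hrow h1⟩
  | union l r =>
    obtain ⟨i4, i5, i6⟩ := hin.union i l r hS
    have hl := Cotree.getElem?_nodes_left hS rfl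
    have hr := Cotree.getElem?_nodes_right hS rfl
    have hlm := List.mem_of_getElem? hl
    have hrm := List.mem_of_getElem? hr
    refine (Runs.ite_pos (t := 60 + (10 + 600 * (n + 1))) (by simp [var, eval, h15, g4, i4])
      ((runs_setup (A := A) (B := B) (n := n) (i := i) (G := l.graph) (H := r.graph)
        (j := i + 1) (k := i + 1 + l.nodes.length) (by omega) (by omega) h15 (by rw [g5, i5])
        (by rw [g6, i6]) (h.rows _ (lt_of hS)) (h.rows _ (lt_of hl)) (h.rows _ (lt_of hr))
        (h.done _ _ le_rfl hl) (h.done _ _ (by omega) hr)).seq fun m₁ ⟨hf, hr₁⟩ => ?_)).mono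
        (by simp only [var, cost]; omega) fun _ h => h
    refine (Runs.ite_neg ?_ (hr₁.runs_unionNode hwf.2.2 (Cotree.isIndep_inter_of_mem hA hlm)
      (Cotree.isIndep_inter_of_mem hA hrm) (Cotree.isIndep_inter_of_mem hB hlm)
      (Cotree.isIndep_inter_of_mem hB hrm))).mono (by simp only [var, cost]; omega)
      fun _ h => ⟨hf.trans h.1, h.2⟩
    simp only [var, eval, hr₁.node]
    rw [hf.off 4 (by simp) (by simp), g4, i4]
  | join l r =>
    obtain ⟨i4, i5, i6⟩ := hin.join i l r hS
    have hl := Cotree.getElem?_nodes_left hS rfl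
    have hr := Cotree.getElem?_nodes_right hS rfl
    have hm := List.mem_of_getElem? hS
    have hAi : (l.graph.join r.graph).IsIndep (A ∩ (l.graph.join r.graph).verts) :=
      Cotree.isIndep_inter_of_mem (S := Cotree.join l r) hA hm
    have hBi : (l.graph.join r.graph).IsIndep (B ∩ (l.graph.join r.graph).verts) :=
      Cotree.isIndep_inter_of_mem (S := Cotree.join l r) hB hm
    -- The left subtree has at least one node, so the children have different numbers and hence
    -- different row addresses.
    have hlen := (List.getElem?_eq_some_iff.1 (Cotree.getElem?_nodes_zero l)).1
    refine (Runs.ite_pos (t := 60 + (10 + 600 * (n + 1))) (by simp [var, eval, h15, g4, i4])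
      ((runs_setup (A := A) (B := B) (n := n) (i := i) (G := l.graph) (H := r.graph)
        (j := i + 1) (k := i + 1 + l.nodes.length) (by omega) (by omega) h15 (by rw [g5, i5])
        (by rw [g6, i6]) (h.rows _ (lt_of hS)) (h.rows _ (lt_of hl)) (h.rows _ (lt_of hr))
        (h.done _ _ le_rfl hl) (h.done _ _ (by omega) hr)).seq fun m₁ ⟨hf, hr₁⟩ => ?_)).mono
        (by simp only [var, cost]; omega) fun _ h => h
    refine (Runs.ite_pos ?_ (hr₁.runs_joinNode hwf.2.2 (by omega) hAi hBi)).mono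
      (by simp only [var, cost]; omega) fun _ h => ⟨hf.trans h.1, h.2⟩
    simp only [var, eval, hr₁.node]
    rw [hf.off 4 (by simp) (by simp), g4, i4]
    simp

theorem RowOK.congr (h : RowOK A B m j H) (heq : ∀ a ∈ [9, 10, 11, 13, 14], m' a = m a) :
    RowOK A B m' j H where
  risA := h.risA.congr (by rw [heq 13 (by simp)]) fun _ _ => by rw [heq 9 (by simp)]
  risB := h.risB.congr (by rw [heq 14 (by simp)]) fun _ _ => by rw [heq 10 (by simp)]
  reach := by rw [heq 11 (by simp)]; exact h.reach

theorem MainInv.congr {s : ℕ} {m'' : Mem} (h : MainInv T A B m s m')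
    (heq : ∀ a < 15, m'' a = m' a) : MainInv T A B m s m'' where
  input := fun a ha => (heq a (by omega)).trans (h.input a ha)
  rows := by rw [heq 12 (by simp)]; exact h.rows
  done := fun j S hj hS => (h.done j S hj hS).congr fun a ha => heq a (by
    simp only [List.mem_cons, List.not_mem_nil, or_false] at ha; omega)
  leaf := fun j H hH => by
    obtain ⟨h1, h2, h3⟩ := h.leaf j H hH
    rw [heq 13 (by simp), heq 14 (by simp)]
    exact ⟨h1, h2, fun hc => (h3 hc).congr fun a ha => heq a (by
      simp only [List.mem_cons, List.not_mem_nil, or_false] at ha; omega)⟩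

theorem MainInv.of_frame {m'' : Mem} (h : MainInv T A B m (i + 1) m')
    {S : Cotree (Fin n)} (hS : T.nodes[i]? = some S) (hf : Frame n i m' m'')
    (hrow : RowOK A B m'' i S.graph) : MainInv T A B m i m'' where
  input := fun a ha => by
    rw [hf.off a (by omega) (by
      simp only [List.mem_cons, List.not_mem_nil, or_false]; omega), h.input a ha]
  rows := by rw [hf.off 12 (by simp) (by simp)]; exact h.rows
  done := fun j S' hj hS' => by
    rcases eq_or_ne j i with rfl | hne
    · rw [hS] at hS'
      cases hS'
      exact hrow
    · exact (h.done j S' (by omega) hS').of_frame hf hne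
  leaf := fun j H hH => by
    rcases eq_or_ne j i with rfl | hne
    · rw [hS] at hH
      cases hH
      exact ⟨hrow.risA.card, hrow.risB.card, fun _ => hrow⟩
    · obtain ⟨h1, h2, h3⟩ := h.leaf j H hH
      exact ⟨(hf.count 13 (by simp) j hne).trans h1, (hf.count 14 (by simp) j hne).trans h2,
        fun hc => (h3 hc).of_frame hf hne⟩

/-- Process the nodes in reverse preorder. -/
def mainLoop : Prog :=
  Prog.loop (var 15) (seq (assign 15 (sub (var 15) (const 1))) nodeRows)

/-- Children have larger preorder numbers than their parent, so descending order finds their rows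
finished. -/
theorem MainInv.runs_mainLoop (hn : 0 < n) (hT : T.WellFormed)
    (hA : T.graph.toSimpleGraph.IsIndepSet (A : Set (Fin n)))
    (hB : T.graph.toSimpleGraph.IsIndepSet (B : Set (Fin n)))
    (hin : IsInput G T k A B m) (h : MainInv T A B m T.nodes.length m')
    (h15 : m' 15 0 = T.nodes.length) :
    Runs mainLoop m' (T.nodes.length * (720 * (n + 1)) + 3) (MainInv T A B m 0) := by
  refine (Runs.loop (Inv := fun s m' => m' 15 0 = s ∧ s ≤ T.nodes.length ∧ MainInv T A B m s m')
    (10 + 700 * (n + 1)) ?_ ⟨h15, le_rfl, h⟩).mono ?_ ?_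
  · rintro s m₁ ⟨h1, h2, h3⟩ hb
    replace hb : m₁ 15 0 ≠ 0 := hb
    obtain ⟨i, rfl⟩ : ∃ i, s = i + 1 := ⟨s - 1, by omega⟩
    refine ⟨i, Nat.lt_succ_self i, ((LoopFree.runs (by simp [LoopFree, assign]) m₁).mono
      (t' := 10) (by simp [time, assign, var, cost]) fun _ h => h).seq fun m₂ h₂ => ?_⟩
    have h₂' : MainInv T A B m (i + 1) m₂ := h3.congr fun a ha => by
      simp [h₂, run, assign, show a ≠ 15 by omega]
    have e15 : m₂ 15 0 = i := by simp [h₂, run, assign, var, eval, h1]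
    have hS := List.getElem?_eq_getElem (l := T.nodes) (i := i) (by omega)
    refine (h₂'.runs_nodeRows hn hT hA hB hin e15 hS).mono le_rfl ?_
    rintro m₃ ⟨hf, hrow⟩
    exact ⟨by rw [hf.off 15 (by simp) (by simp), e15], by omega, h₂'.of_frame hS hf hrow⟩
  · simp only [var, cost]
    exact Nat.add_le_add_right (Nat.mul_le_mul_left _ (by omega)) 3
  · rintro m₁ ⟨hb, s, h1, -, h3⟩
    replace hb : m₁ 15 0 = 0 := hb
    rw [h1] at hb
    rwa [hb] at h3

/-! ### The algorithm -/

/-- Compare the bound with the sizes of the two sets, and look up the answer at the root. -/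
def answer : Prog :=
  ite (add (sub (read 0 (const 1)) (read 13 (const 0))) (sub (read 0 (const 1)) (read 14 (const 0))))
    (assign 0 (const 0)) (assign 0 (read 11 (read 0 (const 1))))

/-- The algorithm that decides reachability from the values at the nontrivial leaves. -/
def decideReach : Prog :=
  seq initRows (seq initCounts (seq (assign 15 (read 0 (const 2))) (seq mainLoop answer)))

-- The root has number `0`, so its entry for `k` is cell `k` of array `11`. The preceding comparison
-- is needed because this cell is unspecified when `k` exceeds one of the sizes.
open Classical in
theorem MainInv.runs_answer (hT : T.graph = FinGraph.ofGraph G)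
    (hin : IsInput G T k A B m) (h : MainInv T A B m 0 m') :
    Runs answer m' 30 (fun m'' =>
      m'' 0 0 = if (FinGraph.ofGraph G).TARReach k A B then 1 else 0) := by
  have hrow := h.done 0 T le_rfl (Cotree.getElem?_nodes_zero T)
  rw [hT] at hrow
  have hu : ∀ S : Finset (Fin n), S ∩ (FinGraph.ofGraph G).verts = S := fun S =>
    Finset.inter_univ S
  have hA := hrow.risA.card
  have hB := hrow.risB.card
  have hr := hrow.reach
  simp only [hu, Nat.zero_mul, Nat.zero_add] at hA hB hr
  have hk : m' 0 1 = k := by rw [h.input 0 (by simp), hin.bound]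
  refine (LoopFree.runs (by simp [answer, LoopFree, assign]) m').mono
    (by simp [answer, time, assign, cost]) ?_
  rintro _ rfl
  have hb : (add (sub (read 0 (const 1)) (read 13 (const 0)))
      (sub (read 0 (const 1)) (read 14 (const 0)))).eval m' = k - A.card + (k - B.card) := by
    simp only [eval, hk, hA, hB]
  rw [answer, run]
  by_cases hle : k ≤ A.card ∧ k ≤ B.card
  · rw [if_pos (by omega)]
    simp only [run, assign, eval, Function.update_self, hk, hr k (le_min hle.1 hle.2)]
  · rw [if_neg (by omega), if_neg fun hc => hle ⟨hc.card_left, hc.card_right⟩]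
    simp only [run, assign, eval, Function.update_self]

open Classical in
theorem runs_decideReach (hT : T.IsGeneralizedCotreeFor G)
    (hA : G.IsIndepSet (A : Set (Fin n))) (hB : G.IsIndepSet (B : Set (Fin n)))
    (hin : IsInput G T k A B m) :
    Runs decideReach m (4000 * n ^ 2) (fun m' =>
      m' 0 0 = if (FinGraph.ofGraph G).TARReach k A B then 1 else 0) := by
  obtain ⟨hwf, hgr⟩ := hT
  have hverts : T.graph.verts = Finset.univ := by rw [hgr]; rfl
  have hG : T.graph.toSimpleGraph = G := by rw [hgr]; rfl
  have hlen := hwf.length_nodes_lt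
  rw [hverts, Finset.card_univ, Fintype.card_fin] at hlen
  have hn : 0 < n := by omega
  have key : Runs decideReach m ((T.nodes.length * 30 + 10) + ((n * 50 + 10) + (10 +
      ((T.nodes.length * (720 * (n + 1)) + 3) + 30)))) (fun m' =>
      m' 0 0 = if (FinGraph.ofGraph G).TARReach k A B then 1 else 0) := by
    refine (runs_initRows hin.order hin.nodeCount (hin.blank 16 (by simp) 0)
      (hin.blank 17 (by simp) 0)).seq fun m₁ ⟨off₁, rows⟩ => ?_
    refine (runs_initCounts (A := A) (B := B) (by rw [off₁ 0 (by simp), hin.order])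
      (by rw [off₁ 2 (by simp)]; exact fun v => (hin.setA v).trans (by congr))
      (by rw [off₁ 3 (by simp)]; exact fun v => (hin.setB v).trans (by congr))
      (by rw [off₁ 13 (by simp)]; exact hin.blank 13 (by simp))
      (by rw [off₁ 14 (by simp)]; exact hin.blank 14 (by simp))
      (by rw [off₁ 18 (by simp)]; exact hin.blank 18 (by simp) 0)).seq
      fun m₂ ⟨off₂, hcA, hcB⟩ => ?_
    refine ((LoopFree.runs (by simp [LoopFree, assign]) m₂).mono (t' := 10)
      (by simp [time, assign, cost]) fun _ h => h).seq fun m₃ h₃ => ?_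
    have off₃ : ∀ a < 15, m₃ a = m₂ a := fun a ha => by
      simp [h₃, run, assign, show a ≠ 15 by omega]
    have hcopy : ∀ a < 12, m₃ a = m a := fun a ha => by
      rw [off₃ a (by omega), off₂ a (by simp only [List.mem_cons, List.not_mem_nil, or_false]; omega),
        off₁ a (by simp only [List.mem_cons, List.not_mem_nil, or_false]; omega)]
    have h15 : m₃ 15 0 = T.nodes.length := by
      simp only [h₃, run, assign, eval, Function.update_self]
      rw [off₂ 0 (by simp), off₁ 0 (by simp), hin.nodeCount]
    have hinv : MainInv T A B m T.nodes.length m₃ := by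
      refine ⟨fun a ha => hcopy a (by omega), ?_, fun j S hj hS => ?_, fun j H hH => ?_⟩
      · rw [off₃ 12 (by simp), off₂ 12 (by simp)]; exact rows
      · exact absurd (List.getElem?_eq_some_iff.1 hS).1 (by omega)
      · have hf : ∀ (j : ℕ) (H : FinGraph (Fin n)), T.nodes[j]? = some (Cotree.leaf H) →
            ∀ v ∈ H.verts, m₁ 8 v = j := fun j H hH => by
          rw [off₁ 8 (by simp)]; exact (hin.leaf j H hH).2.2
        have cA : m₃ 13 j = (A ∩ H.verts).card := by
          rw [off₃ 13 (by simp), hcA, countBelow_eq_card hverts hf hH]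
        have cB : m₃ 14 j = (B ∩ H.verts).card := by
          rw [off₃ 14 (by simp), hcB, countBelow_eq_card hverts hf hH]
        refine ⟨cA, cB, fun h1 => ⟨⟨cA, ?_⟩, ⟨cB, ?_⟩, ?_⟩⟩
        · rw [hcopy 9 (by simp)]; exact hin.risA j H hH h1
        · rw [hcopy 10 (by simp)]; exact hin.risB j H hH h1
        · rw [hcopy 11 (by simp)]; exact hin.reach j H hH h1
    exact (hinv.runs_mainLoop hn hwf (hG ▸ hA) (hG ▸ hB) hin h15).seq fun m₄ h₄ =>
      h₄.runs_answer hgr hin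
  refine key.mono ?_ fun _ h => h
  -- At most `2 * n - 1` nodes at `720 * (n + 1)` steps each give the quadratic term; the
  -- preparations are linear, and `4000` is generous.
  have h1 : T.nodes.length * (720 * (n + 1)) ≤ (2 * n - 1) * (720 * (n + 1)) :=
    Nat.mul_le_mul_right _ (by omega)
  obtain ⟨p, rfl⟩ : ∃ p, n = p + 1 := ⟨n - 1, by omega⟩
  rw [show 2 * (p + 1) - 1 = 2 * p + 1 by omega] at h1
  nlinarith

end Algorithm

end ISR

open Classical in
theorem theorem2 :
    ∃ (P : ISR.Prog) (C : ℕ), ∀ (n : ℕ) (G : SimpleGraph (Fin n)) (T : ISR.Cotree (Fin n)) (k : ℕ)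
      (A B : Finset (Fin n)) (m : ISR.Mem),
      T.IsGeneralizedCotreeFor G →
      G.IsIndepSet (A : Set (Fin n)) → G.IsIndepSet (B : Set (Fin n)) →
      ISR.IsInput G T k A B m →
      ∃ (t : ℕ) (m' : ISR.Mem), ISR.Exec P m t m' ∧ t ≤ C * n ^ 2 ∧
        m' 0 0 = if (ISR.FinGraph.ofGraph G).TARReach k A B then 1 else 0 := by
  exact ⟨ISR.decideReach, 4000, fun n G T k A B m hT hA hB hin =>
    ISR.runs_decideReach hT hA hB hin⟩
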